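/- Let $(X_i)_{i\ge 1}$ be finite sets with $|X_i|\ge 2$, put $L_n=\prod_{i=1}^n X_i$ (with $L_0=\{\epsilon\}$), and let $\mathcal T$ be the rooted tree with vertex set $\bigsqcup_{n\ge 0}L_n$ and root $\epsilon$, in which $u\in L_n$ and $v\in L_{n+1}$ are joined by an edge exactly if $u$ is a prefix of $v$. For $u\in L_n$ let $D(u)\subseteq L_{n+1}$ be the set of neighbours of $u$ in $L_{n+1}$, and let $\partial\mathcal T=\prod_{i\ge 1}X_i$ with the product topology of the discrete topologies. Let $\mathcal G$ be the group of root-preserving automorphisms of $\mathcal T$ with the topology of pointwise convergence on vertices; it acts on $\partial\mathcal T$. Let $G\le\mathcal G$ be a subgroup that acts locally $2$-transitively, i.e. $G$ is transitive on every $L_n$, and for all $n$ and all distinct $u,v\in L_n$ the group $\mathrm{St}_G(u)\cap \mathrm{St}_G(v)$ acts transitively on $D(u)\times D(v)$. Let $\overline G$ be the closure of $G$ in $\mathcal G$ and let $F$ be a field whose characteristic does not divide the Steinitz order of $\overline G$, i.e. $\mathrm{char}(F)$ does not divide the order of any finite continuous quotient of $\overline G$. For a vertex $v$ let $\theta_v$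 be the permutation representation of $\mathrm{St}_G(v)$ on $F[D(v)]$, for an irreducible representation $\pi$ of $\mathrm{St}_G(v)$ let $m(\pi,\theta_v)$ be its multiplicity in $\theta_v$, and let $\mathrm{Irr}^0_F(v)$ be the set of isomorphism classes of nontrivial irreducible $F$-representations $\pi$ of $\mathrm{St}_G(v)$ with $m(\pi,\theta_v)\ne 0$. For a representation $(\pi,V)$ of $\mathrm{St}_G(v)$ let $\mathrm{Ind}_{\mathrm{St}_G(v)}^G(\pi)$ be the representation of $G$ by right translation on $\{f\colon G\to V\mid f(sx)=\pi(s)f(x)\text{ for all } s\in \mathrm{St}_G(v),\ x\in G\}$. Let $\rho_{\partial}$ be the representation of $G$ on the space of locally constant functions $f\colon\partial\mathcal T\to F$ given by $(\rho_\partial(g)f)(\xi)=f(g^{-1}\xi)$. Then: 1. For every vertex $v$ and every $\pi\in\mathrm{Irr}^0_F(v)$ the representation $\mathrm{Ind}_{\mathrm{St}_G(v)}^G(\pi)$ is irreducible. 2. For every choice of vertices $v_n\in L_n$ ($n\ge 0$) there is an isomorphism of representations of $G$ $$\rho_{\partial}\;\cong\;\mathrm{triv}_F\;\oplus\;\bigoplus_{n\ge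 0}\ \bigoplus_{\pi\in\mathrm{Irr}^0_F(v_n)} m(\pi,\theta_{v_n})\;\mathrm{Ind}_{\mathrm{St}_G(v_n)}^G(\pi),$$ where $\mathrm{triv}_F$ is the trivial representation on $F$. The irreducible representations $\mathrm{triv}_F$ and $\mathrm{Ind}_{\mathrm{St}_G(v_n)}^G(\pi)$, for $n\ge 0$ and $\pi\in \mathrm{Irr}^0_F(v_n)$, are pairwise non-isomorphic. -/

import Mathlib

universe u v w

namespace RootedTree

/-! ### The spherically symmetric rooted tree based on a sequence of finite sets

The sets are indexed from `0`: a vertex of level `n` is a word `(x 0, …, x (n - 1))` with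
`x i ∈ X i`. -/

/-- The vertices: finite words, together with their length (the level of the vertex). -/
structure Vertex (X : ℕ → Type v) : Type v where
  level : ℕ
  word : (i : Fin level) → X i

/-- The root is the empty word. -/
def root (X : ℕ → Type v) : Vertex X := ⟨0, fun i => i.elim0⟩

/-- `b` is one level further than `a`, and `a` is a prefix of `b`. -/
def IsChild {X : ℕ → Type v} (a b : Vertex X) : Prop :=
  b.level = a.level + 1 ∧ ∀ (i : ℕ) (ha : i < a.level) (hb : i < b.level), a.word ⟨i, ha⟩ = b.word ⟨i, hb⟩

/-- The rooted tree as a graph. -/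
def tree (X : ℕ → Type v) : SimpleGraph (Vertex X) where
  Adj a b := IsChild a b ∨ IsChild b a
  symm := ⟨fun _ _ h => h.symm⟩
  loopless := ⟨fun a h => by
    rcases h with h | h <;> exact absurd h.1 (by omega)⟩

/-- The group of root-preserving automorphisms of the tree. -/
def rootedAut (X : ℕ → Type v) : Subgroup (tree X ≃g tree X) :=
  MulAction.stabilizer (tree X ≃g tree X) (root X)

/-- The descendants of `a`: the neighbours of `a` that lie in the next level. -/
def descendants {X : ℕ → Type v} (a : Vertex X) : Set (Vertex X) :=
  {b | (tree X).Adj a b ∧ b.level = a.level + 1}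

variable {X : ℕ → Type v}

/-! ### Automorphisms preserve levels -/

theorem smul_adj (g : rootedAut X) {a b : Vertex X} :
    (tree X).Adj (g • a) (g • b) ↔ (tree X).Adj a b :=
  g.1.map_rel_iff

theorem smul_root (g : rootedAut X) : g • root X = root X := g.2

theorem vertex_ext {a b : Vertex X} (h : a.level = b.level)
    (h' : ∀ (i : ℕ) (ha : i < a.level) (hb : i < b.level), a.word ⟨i, ha⟩ = b.word ⟨i, hb⟩) : a = b := by
  obtain ⟨n, a⟩ := a
  obtain ⟨m, b⟩ := b
  obtain rfl : n = m := h
  congr 1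
  funext i
  exact h' i i.2 i.2

theorem parent_unique {a b c : Vertex X} (h : IsChild a c) (h' : IsChild b c) : a = b := by
  have e : a.level = b.level := by have := h.1; have := h'.1; omega
  refine vertex_ext e fun i ha hb => ?_
  have hc : i < c.level := by have := h.1; omega
  rw [h.2 i ha hc, h'.2 i hb hc]

/-- The prefix of length `n` of a word of length at least `n`. -/
def pre (a : Vertex X) (n : ℕ) (h : n ≤ a.level) : Vertex X :=
  ⟨n, fun i => a.word ⟨i, lt_of_lt_of_le i.2 h⟩⟩

theorem pre_isChild (a : Vertex X) (n : ℕ) (h : n + 1 = a.level) :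
    IsChild (pre a n (by omega)) a :=
  ⟨h.symm, fun _ _ _ => rfl⟩

theorem eq_root {a : Vertex X} (h : a.level = 0) : a = root X :=
  vertex_ext h fun i ha _ => absurd ha (by omega)

theorem smul_level (g : rootedAut X) (a : Vertex X) : (g • a).level = a.level := by
  suffices H : ∀ n : ℕ, ∀ a : Vertex X, a.level = n → (g • a).level = n from H _ a rfl
  intro n
  induction n using Nat.strong_induction_on with
  | _ n ih =>
    intro a ha
    rcases n with _ | n
    · rw [eq_root ha, smul_root]; rfl
    · have hp := pre_isChild a n ha.symm
      have hpl := ih n (Nat.lt_succ_self n) (pre a n (by omega)) rfl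
      rcases (smul_adj g).2 (Or.inl hp : (tree X).Adj _ _) with h | h
      · rw [h.1, hpl]
      · exfalso
        have h1 := h.1
        rw [hpl] at h1
        rcases n with _ | m
        · omega
        · have hq := pre_isChild (pre a (m + 1) (by omega)) m rfl
          have hql := ih m (by omega) (pre (pre a (m + 1) (by omega)) m (Nat.le_succ m)) rfl
          rcases (smul_adj g).2 (Or.inl hq : (tree X).Adj _ _) with h' | h'
          · have e := MulAction.injective g (parent_unique h' h)
            have := congrArg Vertex.level e
            simp only [pre] at this
            omega
          · have := h'.1
            omega

theorem smul_isChild (g : rootedAut X) {a b : Vertex X} (h : IsChild a b) :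
    IsChild (g • a) (g • b) := by
  rcases (smul_adj g).2 (Or.inl h : (tree X).Adj _ _) with h' | h'
  · exact h'
  · have h1 := h'.1
    rw [smul_level, smul_level, h.1] at h1
    omega

theorem smul_mem_descendants (g : rootedAut X) {a b : Vertex X} (hb : b ∈ descendants a) :
    g • b ∈ descendants (g • a) :=
  ⟨(smul_adj g).2 hb.1, by rw [smul_level, smul_level, hb.2]⟩

/-! ### The topology of the automorphism group -/

/-- The topology of pointwise convergence on the (discrete) set of vertices. -/
instance : TopologicalSpace (rootedAut X) :=
  TopologicalSpace.induced (fun g (a : Vertex X) => g • a)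
    (@Pi.topologicalSpace (Vertex X) (fun _ => Vertex X) fun _ => ⊥)

theorem continuous_rootedAut_iff {Y : Type*} [TopologicalSpace Y] {f : Y → rootedAut X} :
    Continuous f ↔ ∀ a b : Vertex X, IsOpen {y | f y • a = b} := by
  rw [continuous_induced_rng]
  let _ : TopologicalSpace (Vertex X) := ⊥
  have _ : DiscreteTopology (Vertex X) := ⟨rfl⟩
  constructor
  · intro h a b
    exact (isOpen_discrete {b}).preimage ((continuous_pi_iff.1 h) a)
  · intro h
    refine continuous_pi fun a => continuous_discrete_rng.2 fun b => h a b

theorem isOpen_smul_eq (a b : Vertex X) : IsOpen {g : rootedAut X | g • a = b} :=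
  continuous_rootedAut_iff.1 (continuous_id (X := rootedAut X)) a b

instance : IsTopologicalGroup (rootedAut X) where
  continuous_mul := by
    refine continuous_rootedAut_iff.2 fun a b => ?_
    have : {p : rootedAut X × rootedAut X | (p.1 * p.2) • a = b} =
        ⋃ c : Vertex X, {g | g • c = b} ×ˢ {h | h • a = c} := by
      ext p
      simp [mul_smul]
    rw [this]
    exact isOpen_iUnion fun c => (isOpen_smul_eq c b).prod (isOpen_smul_eq a c)
  continuous_inv := by
    refine continuous_rootedAut_iff.2 fun a b => ?_
    have : {g : rootedAut X | g⁻¹ • a = b} = {g | g • b = a} := by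
      ext g
      simp only [Set.mem_ofPred_eq]
      rw [inv_smul_eq_iff, eq_comm]
    rw [this]
    exact isOpen_smul_eq b a

/-! ### The boundary -/

/-- The boundary of the tree: infinite words. -/
def Boundary (X : ℕ → Type v) : Type v := (i : ℕ) → X i

/-- The product topology of the discrete topologies. -/
instance : TopologicalSpace (Boundary X) :=
  @Pi.topologicalSpace ℕ X fun _ => ⊥

/-- The vertex of level `n` on the ray `ξ`. -/
def Boundary.pre (ξ : Boundary X) (n : ℕ) : Vertex X := ⟨n, fun i => ξ i⟩

theorem Boundary.pre_isChild (ξ : Boundary X) (n : ℕ) :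
    IsChild (ξ.pre n) (ξ.pre (n + 1)) :=
  ⟨rfl, fun _ _ _ => rfl⟩

/-- The image ray `g ξ`: its `i`-th letter is the last letter of the image under `g` of the
vertex of level `i + 1` on `ξ`. -/
instance : SMul (rootedAut X) (Boundary X) where
  smul g ξ := fun i => (g • ξ.pre (i + 1)).word
    ⟨i, by rw [smul_level]; exact Nat.lt_succ_self i⟩

theorem Boundary.smul_apply (g : rootedAut X) (ξ : Boundary X) (i : ℕ) :
    (g • ξ) i = (g • ξ.pre (i + 1)).word ⟨i, by rw [smul_level]; exact Nat.lt_succ_self i⟩ := rfl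

/-- The ray `g ξ` passes through the images under `g` of the vertices on `ξ`. -/
theorem Boundary.smul_pre (g : rootedAut X) (ξ : Boundary X) (n : ℕ) :
    (g • ξ).pre n = g • ξ.pre n := by
  induction n with
  | zero => rw [eq_root (a := ξ.pre 0) rfl, smul_root, eq_root (a := (g • ξ).pre 0) rfl]
  | succ n ih =>
    refine vertex_ext (by rw [smul_level]; rfl) fun i ha hb => ?_
    have hc := smul_isChild g (ξ.pre_isChild n)
    rcases Nat.lt_succ_iff_lt_or_eq.1 (show i < n + 1 from ha) with h | h
    · have hl : i < (g • ξ.pre n).level := by rw [smul_level]; exact h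
      rw [← hc.2 i hl hb]
      have key : ∀ (c : Vertex X) (_ : (g • ξ).pre n = c) (h' : i < c.level),
          (g • ξ) i = c.word ⟨i, h'⟩ := by
        rintro c rfl h'
        rfl
      exact key _ ih hl
    · subst h
      rfl

theorem Boundary.ext_pre {ξ η : Boundary X} (h : ∀ n, ξ.pre n = η.pre n) : ξ = η := by
  funext i
  have key : ∀ (c : Vertex X) (_ : ξ.pre (i + 1) = c) (h' : i < c.level), ξ i = c.word ⟨i, h'⟩ := by
    rintro c rfl h'
    rfl
  exact key _ (h (i + 1)) (Nat.lt_succ_self i)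

instance : MulAction (rootedAut X) (Boundary X) where
  one_smul ξ := Boundary.ext_pre fun n => by rw [Boundary.smul_pre, one_smul]
  mul_smul g h ξ := Boundary.ext_pre fun n => by
    rw [Boundary.smul_pre, mul_smul, Boundary.smul_pre, Boundary.smul_pre]

instance : ContinuousConstSMul (rootedAut X) (Boundary X) where
  continuous_const_smul g := by
    let _ : ∀ i, TopologicalSpace (X i) := fun _ => ⊥
    have _ : ∀ i, DiscreteTopology (X i) := fun _ => ⟨rfl⟩
    refine continuous_pi (A := X) fun i => ?_
    refine continuous_def.2 fun s _ => isOpen_iff_mem_nhds.2 fun ξ hξ => ?_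
    have ho : IsOpen (Set.pi (Set.Iio (i + 1)) fun j => ({ξ j} : Set (X j))) :=
      isOpen_set_pi (Set.finite_Iio _) fun _ _ => isOpen_discrete _
    refine Filter.mem_of_superset (ho.mem_nhds fun j _ => rfl) fun η hη => ?_
    have e : η.pre (i + 1) = ξ.pre (i + 1) :=
      vertex_ext rfl fun j hj _ => hη j hj
    show (g • η) i ∈ s
    have key : ∀ (c d : Vertex X) (_ : c = d) (hc : i < c.level) (hd : i < d.level),
        c.word ⟨i, hc⟩ = d.word ⟨i, hd⟩ := by
      rintro c _ rfl hc hd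
      rfl
    have : (g • η) i = (g • ξ) i := key _ _ (by rw [e]) _ _
    rw [this]
    exact hξ

/-! ### Locally 2-transitive actions and the Steinitz order -/

/-- `G` acts transitively on every level. -/
def IsSphericallyTransitive (G : Subgroup (rootedAut X)) : Prop :=
  ∀ a b : Vertex X, a.level = b.level → ∃ g ∈ G, g • a = b

/-- `G` is spherically transitive, and for distinct vertices `a`, `b` of the same level the
common stabiliser of `a` and `b` is transitive on pairs of descendants. -/
def IsLocallyTwoTransitive (G : Subgroup (rootedAut X)) : Prop :=
  IsSphericallyTransitive G ∧
    ∀ a b : Vertex X, a.level = b.level → a ≠ b →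
      ∀ a₁ ∈ descendants a, ∀ b₁ ∈ descendants b, ∀ a₂ ∈ descendants a, ∀ b₂ ∈ descendants b,
        ∃ g ∈ G, g • a = a ∧ g • b = b ∧ g • a₁ = a₂ ∧ g • b₁ = b₂

/-- The characteristic of `F` does not divide the order of any finite continuous quotient of the
topological group `H`. -/
def CharNotDvdSteinitzOrder (F : Type*) [Field F] (H : Type*) [Group H] [TopologicalSpace H] :
    Prop :=
  ∀ N : OpenNormalSubgroup H, Finite (H ⧸ N.toSubgroup) →
    ¬ ringChar F ∣ Nat.card (H ⧸ N.toSubgroup)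

/-! ### Representations -/

/-- The multiplicity of `π` in `θ`: the largest `k` such that the direct sum of `k` copies of `π`
embeds into `θ`. It is used for irreducible `π` and finite-dimensional `θ`. -/
noncomputable def mult {F H V W : Type*} [Field F] [Group H] [AddCommGroup V] [Module F V]
    [AddCommGroup W] [Module F W] (π : Representation F H V) (θ : Representation F H W) : ℕ :=
  sSup {k : ℕ | ∃ f : Representation.IntertwiningMap
    (Representation.directSum fun _ : Fin k => π) θ, Function.Injective f}

/-- The stabiliser of a vertex in `G`. -/
abbrev St (G : Subgroup (rootedAut X)) (a : Vertex X) : Subgroup G := MulAction.stabilizer G a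

instance (G : Subgroup (rootedAut X)) (a : Vertex X) : MulAction (St G a) (descendants a) where
  smul g b := ⟨g • b.1, by
    have h := smul_mem_descendants (g.1.1) b.2
    have e : g.1.1 • a = a := g.2
    rw [e] at h
    exact h⟩
  one_smul b := Subtype.ext (one_smul _ b.1)
  mul_smul g h b := Subtype.ext (mul_smul g h b.1)

/-- The permutation representation of the stabiliser of `a` on the free vector space over the
descendants of `a`. -/
noncomputable abbrev descRep (F : Type u) [Field F] (G : Subgroup (rootedAut X)) (a : Vertex X) :=
  Representation.ofMulAction F (St G a) (descendants a)

/-- `π` is a nontrivial irreducible representation of the stabiliser of `a` that occurs in the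
permutation representation on the descendants of `a`. -/
structure IsNontrivialConstituent {F : Type u} [Field F] (G : Subgroup (rootedAut X))
    (a : Vertex X) {V : Type w} [AddCommGroup V] [Module F V]
    (π : Representation F (St G a) V) : Prop where
  irreducible : π.IsIrreducible
  nontrivial : ¬ π.IsTrivial
  occurs : mult π (descRep F G a) ≠ 0

/-- A nontrivial irreducible constituent, with its space. -/
structure Constituent (F : Type u) [Field F] (G : Subgroup (rootedAut X)) (a : Vertex X) :
    Type (max v (u + 1)) where
  V : Type u
  [addCommGroup : AddCommGroup V]
  [module : Module F V]
  rep : Representation F (St G a) V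
  isConstituent : IsNontrivialConstituent G a rep

attribute [instance] Constituent.addCommGroup Constituent.module

/-- Isomorphism of representations. -/
instance Constituent.setoid (F : Type u) [Field F] (G : Subgroup (rootedAut X)) (a : Vertex X) :
    Setoid (Constituent F G a) where
  r π σ := Nonempty (Representation.Equiv π.rep σ.rep)
  iseqv :=
    { refl := fun _ => ⟨Representation.Equiv.refl _⟩
      symm := fun ⟨e⟩ => ⟨e.symm⟩
      trans := fun ⟨e⟩ ⟨f⟩ => ⟨e.trans f⟩ }

/-- The set of isomorphism classes of nontrivial irreducible representations of the stabiliser of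
`a` that occur in the permutation representation on the descendants of `a`. These representations
are finite-dimensional, so that spaces in the universe of `F` give all of them. -/
def Irr₀ (F : Type u) [Field F] (G : Subgroup (rootedAut X)) (a : Vertex X) :
    Type (max v (u + 1)) :=
  Quotient (Constituent.setoid F G a)

/-- A representation in a given isomorphism class. -/
noncomputable def Irr₀.out {F : Type u} [Field F] {G : Subgroup (rootedAut X)} {a : Vertex X}
    (c : Irr₀ F G a) : Constituent F G a :=
  Quotient.out c

/-- The multiplicity of a class in the permutation representation on the descendants. -/
noncomputable def Irr₀.mult {F : Type u} [Field F] {G : Subgroup (rootedAut X)} {a : Vertex X}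
    (c : Irr₀ F G a) : ℕ :=
  RootedTree.mult c.out.rep (descRep F G a)

/-- The representation induced from the stabiliser of `a` to `G`, on the space of all
`f : G → V` with `f (s x) = π s (f x)` for `s` in the stabiliser, by right translation. -/
abbrev ind {F : Type u} [Field F] (G : Subgroup (rootedAut X)) (a : Vertex X) {V : Type w}
    [AddCommGroup V] [Module F V] (π : Representation F (St G a) V) :
    Representation F G (Representation.coindV (St G a).subtype π) :=
  Representation.coind (St G a).subtype π

/-- The representation of `G` on locally constant functions on the boundary,
`(g f) ξ = f (g⁻¹ ξ)`. -/
noncomputable def boundaryRep (F : Type u) [Field F] (G : Subgroup (rootedAut X)) :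
    Representation F G (LocallyConstant (Boundary X) F) where
  toFun g := LocallyConstant.comapₗ F ⟨fun ξ => g⁻¹ • ξ, continuous_const_smul (g⁻¹).1⟩
  map_one' := by
    ext f ξ
    simp
  map_mul' g h := by
    ext f ξ
    simp [mul_smul]

end RootedTree

/-! Fix a vertex `a` with a descendant `b`, and put H = St(a), K = St(b) ≤ H. Applied to `a` and
g⁻¹a, local 2-transitivity gives Hg ⊆ KgK for every g outside H (`exists_double_coset`). A
constituent π of F[D(a)] carries a nonzero K-invariant functional l, the evaluation at `b`
(`exists_functional`). For a K-invariant f in Ind(π) and g outside H, the double coset relation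
makes l(π(h) f(g)) independent of h in H. The translates of l separate points, so f(g) is an
H-invariant vector of π and vanishes: K-invariant vectors are supported on H
(`coind_apply_eq_zero`).

Everything acts through the finite group induced on the level of `b`, whose order is invertible in
F. Averaging over K therefore produces a nonzero K-invariant vector in every nonzero
subrepresentation (`exists_invariant_mem`). Such a vector is supported on H, and its translates
generate Ind(π), because π is irreducible; so Ind(π) is irreducible. An isomorphism Ind(π) ≅ Ind(σ)
preserves K-invariant vectors, and so restricts to a nonzero map π → σ. Different levels are told
apart by fixed vectors: Ind(π) has a nonzero vector fixed by the stabiliser of any vertex one level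
below `a`, but none fixed by St(a).

For the decomposition, an embedding of π into F[D(a)] spreads elements of Ind(π) over the vertices
of the next level (`boundaryMap`). Functions of level at most that of `a` are constant on each
D(ga), hence killed by projections to nontrivial constituents. The sum of all these maps is thus
triangular with respect to the level, which gives injectivity. For surjectivity, functions of level
n + 1 are spanned by translates of functions on one D(a), and F[D(a)] consists of its nontrivial
constituents and constants; the constants come from level n. -/

namespace RootedTree

/-! ### Coinduced representations and vectors invariant under a smaller subgroup -/

section Abstract

variable {F G V W Q : Type*} [Field F] [Group G] [AddCommGroup V] [Module F V] [AddCommGroup W]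
  [Module F W] [Group Q] [Finite Q]

/-- Averaging over a group that acts through a finite group of invertible order. -/
theorem exists_average (ρ : Representation F G V) (p : G →* Q) (hp : ∀ g, p g = 1 → ρ g = 1)
    (hc : (Nat.card p.range : F) ≠ 0) (x : V) :
    ∃ y, (∀ g, ρ g y = y) ∧ ∀ U : Submodule F V, (∀ g, ρ g x - x ∈ U) → y - x ∈ U := by
  classical
  have : Fintype p.range := Fintype.ofFinite _
  have hlift : ∀ q : p.range, ∃ g, p g = q := fun q => q.2
  choose l hl using hlift
  -- `ρ` factors through `p`, so the average may be taken over the image of `p` with arbitrary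
  -- lifts.
  have key : ∀ g g', p g = p g' → ρ g = ρ g' := fun g g' h => by
    have h1 : ρ (g⁻¹ * g') = 1 := hp _ (by simp [h])
    rw [← mul_one (ρ g), ← h1, ← map_mul, mul_inv_cancel_left]
  rw [Nat.card_eq_fintype_card] at hc
  refine ⟨(Fintype.card p.range : F)⁻¹ • ∑ q, ρ (l q) x, fun g => ?_, fun U hU => ?_⟩
  · rw [map_smul, map_sum]
    congr 1
    refine Fintype.sum_equiv (Equiv.mulLeft (p.rangeRestrict g)) _ _ fun q => ?_
    rw [← Module.End.mul_apply, ← map_mul]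
    congr 1
    apply key
    simp [hl]
  · have : (Fintype.card p.range : F)⁻¹ • ∑ q, ρ (l q) x - x =
        (Fintype.card p.range : F)⁻¹ • ∑ q, (ρ (l q) x - x) := by
      rw [Finset.sum_sub_distrib, smul_sub, Finset.sum_const, Finset.card_univ,
        ← Nat.cast_smul_eq_nsmul F, smul_smul, inv_mul_cancel₀ hc, one_smul]
    rw [this]
    exact U.smul_mem _ (U.sum_mem fun q _ => hU _)

theorem mem_eq_top_of_irreducible {π : Representation F G V} (hπ : π.IsIrreducible)
    (U : Submodule F V) (hU : ∀ g, ∀ x ∈ U, π g x ∈ U) {x : V} (hx : x ∈ U) (hx0 : x ≠ 0) (y : V) :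
    y ∈ U := by
  rcases hπ.eq_bot_or_eq_top ⟨U, hU⟩ with h | h
  · have : x ∈ (⊥ : Subrepresentation π).toSubmodule := h ▸ hx
    exact absurd ((Submodule.mem_bot F).1 this) hx0
  · have : y ∈ (⊤ : Subrepresentation π).toSubmodule := Submodule.mem_top
    rw [← h] at this
    exact this

theorem isIrreducible_of_forall {π : Representation F G V} [Nontrivial V]
    (h : ∀ U : Submodule F V, (∀ g, ∀ x ∈ U, π g x ∈ U) → ∀ x ∈ U, x ≠ 0 → ∀ y, y ∈ U) :
    π.IsIrreducible where
  exists_pair_ne := ⟨⊥, ⊤, fun e => bot_ne_top (congrArg Subrepresentation.toSubmodule e)⟩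
  eq_bot_or_eq_top U := by
    by_cases hU : U.toSubmodule = ⊥
    · exact Or.inl (Subrepresentation.toSubmodule_injective hU)
    · obtain ⟨x, hx, hx0⟩ := Submodule.exists_mem_ne_zero_of_ne_bot hU
      exact Or.inr (Subrepresentation.toSubmodule_injective
        (Submodule.eq_top_iff'.2 (h U.toSubmodule (fun g x hx => U.apply_mem_toSubmodule g hx) x hx hx0)))

theorem nontrivial_of_irreducible {π : Representation F G V} (hπ : π.IsIrreducible) :
    Nontrivial V := by
  by_contra h
  rw [not_nontrivial_iff_subsingleton] at h
  obtain ⟨a, b, hab⟩ := hπ.exists_pair_ne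
  exact hab (Subrepresentation.toSubmodule_injective (Subsingleton.elim _ _))

/-- A nontrivial irreducible representation has no invariant vectors. -/
theorem eq_zero_of_invariant {π : Representation F G V} (hπ : π.IsIrreducible)
    (ht : ¬ π.IsTrivial) {x : V} (hx : ∀ g, π g x = x) : x = 0 := by
  by_contra h0
  refine ht ⟨fun g => LinearMap.ext fun y => ?_⟩
  -- The invariants form a subrepresentation; if nonzero, it is the whole space and `π` is trivial.
  exact mem_eq_top_of_irreducible hπ (π.invariants) (fun g x hx => by rwa [hx g])
    (x := x) hx h0 y g

/-- The translates of a nonzero functional on an irreducible representation separate points. -/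
theorem eq_zero_of_functional {π : Representation F G V} (hπ : π.IsIrreducible) {l : V →ₗ[F] W}
    (hl : l ≠ 0) {x : V} (hx : ∀ g, l (π g x) = 0) : x = 0 := by
  by_contra h0
  -- The largest subrepresentation contained in the kernel of `l`.
  let U : Submodule F V := ⨅ g, LinearMap.ker (l ∘ₗ π g)
  have hU : ∀ {y}, y ∈ U ↔ ∀ g, l (π g y) = 0 := by simp [U, Submodule.mem_iInf]
  refine hl (LinearMap.ext fun y => ?_)
  have := hU.1 (mem_eq_top_of_irreducible hπ U (fun g x hx => ?_) (hU.2 hx) h0 y) 1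
  · simpa using this
  · refine hU.2 fun k => ?_
    rw [← Module.End.mul_apply, ← map_mul]
    exact hU.1 hx _

variable (H K : Subgroup G) (π : Representation F H V)

open Classical in
/-- The element of the coinduced representation that is supported on `H` and maps `1` to `x`. -/
noncomputable def coindSingle : V →ₗ[F] Representation.coindV H.subtype π where
  toFun x := ⟨fun g => if h : g ∈ H then π ⟨g, h⟩ x else 0, fun h g => by
    by_cases hg : g ∈ H
    · have h1 : H.subtype h * g ∈ H := H.mul_mem h.2 hg
      beta_reduce
      rw [dif_pos hg, dif_pos h1, ← Module.End.mul_apply, ← map_mul]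
      rfl
    · have h1 : H.subtype h * g ∉ H := fun h' => hg ((H.mul_mem_cancel_left h.2).1 h')
      beta_reduce
      rw [dif_neg hg, dif_neg h1, map_zero]⟩
  map_add' x y := by
    ext g
    by_cases hg : g ∈ H <;> simp [hg]
  map_smul' c x := by
    ext g
    by_cases hg : g ∈ H <;> simp [hg]

variable {H K π}

theorem coindSingle_apply_mem (x : V) {g : G} (hg : g ∈ H) :
    (coindSingle H π x).1 g = π ⟨g, hg⟩ x := dif_pos hg

theorem coindSingle_apply_notMem (x : V) {g : G} (hg : g ∉ H) :
    (coindSingle H π x).1 g = 0 := dif_neg hg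

theorem coindSingle_apply_one (x : V) : (coindSingle H π x).1 1 = x := by
  rw [coindSingle_apply_mem x H.one_mem]
  exact congrArg (fun f : Module.End F V => f x) (map_one π)

theorem coind_apply_mul (f : Representation.coindV H.subtype π) {h : G} (hh : h ∈ H) (g : G) :
    f.1 (h * g) = π ⟨h, hh⟩ (f.1 g) := f.2 ⟨h, hh⟩ g

theorem coind_val (g : G) (f : Representation.coindV H.subtype π) (x : G) :
    (Representation.coind H.subtype π g f).1 x = f.1 (x * g) := rfl

theorem eq_coindSingle {f : Representation.coindV H.subtype π} (hf : ∀ g ∉ H, f.1 g = 0) :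
    f = coindSingle H π (f.1 1) := by
  ext g
  by_cases hg : g ∈ H
  · rw [coindSingle_apply_mem _ hg, ← coind_apply_mul, mul_one]
  · rw [coindSingle_apply_notMem _ hg, hf g hg]

theorem coindSingle_map (h : G) (hh : h ∈ H) (x : V) :
    coindSingle H π (π ⟨h, hh⟩ x) = Representation.coind H.subtype π h (coindSingle H π x) := by
  symm
  have h1 := eq_coindSingle (f := Representation.coind H.subtype π h (coindSingle H π x)) ?_
  · rw [h1, coind_val, one_mul, coindSingle_apply_mem x hh]
  · intro g hg
    rw [coind_val, coindSingle_apply_notMem]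
    exact fun h' => hg ((H.mul_mem_cancel_right hh).1 h')

/-- The coinduced representation is spanned by the translates of the elements supported on `H`. -/
theorem coind_mem_of_coindSingle_mem [Finite (G ⧸ H)]
    (U : Submodule F (Representation.coindV H.subtype π))
    (hU : ∀ g, ∀ f ∈ U, Representation.coind H.subtype π g f ∈ U)
    (h : ∀ x, coindSingle H π x ∈ U) (f : Representation.coindV H.subtype π) : f ∈ U := by
  classical
  have : Fintype (G ⧸ H) := Fintype.ofFinite _
  -- The summand of the coset zH is the restriction of `f` to the right coset Hz⁻¹, so at `x` only
  -- the coset of `x⁻¹` contributes.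
  have key : f = ∑ z : G ⧸ H, Representation.coind H.subtype π z.out
      (coindSingle H π (f.1 z.out⁻¹)) := by
    ext x
    rw [AddSubmonoidClass.coe_finsetSum, Finset.sum_apply,
      Finset.sum_eq_single ((x⁻¹ : G) : G ⧸ H)]
    · have hm : x * ((x⁻¹ : G) : G ⧸ H).out ∈ H := by
        have := QuotientGroup.mk_out_eq_mul H x⁻¹
        obtain ⟨k, hk⟩ := this
        rw [hk]
        simp
      rw [coind_val, coindSingle_apply_mem _ hm, ← coind_apply_mul, mul_inv_cancel_right]
    · intro z _ hz
      rw [coind_val, coindSingle_apply_notMem]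
      intro hm
      apply hz
      rw [← QuotientGroup.out_eq' z]
      rw [eq_comm, QuotientGroup.eq]
      simpa using hm
    · simp
  rw [key]
  exact U.sum_mem fun z _ => hU _ _ (h _)

/-- The vectors that are invariant under `K` are supported on `H`. -/
theorem coind_apply_eq_zero (hKH : K ≤ H)
    (hC : ∀ g ∉ H, ∀ h ∈ H, ∃ k ∈ K, ∃ k' ∈ K, h * g = k * g * k')
    (hπ : π.IsIrreducible) (ht : ¬ π.IsTrivial) {l : V →ₗ[F] W} (hl : l ≠ 0)
    (hlK : ∀ k (hk : k ∈ K) x, l (π ⟨k, hKH hk⟩ x) = l x)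
    {f : Representation.coindV H.subtype π}
    (hf : ∀ k ∈ K, Representation.coind H.subtype π k f = f) {g : G} (hg : g ∉ H) : f.1 g = 0 := by
  have key : ∀ h : H, l (π h (f.1 g)) = l (f.1 g) := by
    rintro ⟨h, hh⟩
    obtain ⟨k, hk, k', hk', e⟩ := hC g hg h hh
    rw [← coind_apply_mul, e, mul_assoc, coind_apply_mul _ (hKH hk), hlK k hk, ← coind_val, hf k' hk']
  -- By `key`, every translate of `l` kills π(h) f(g) − f(g), so f(g) is `H`-invariant.
  refine eq_zero_of_invariant hπ ht fun h => ?_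
  rw [← sub_eq_zero]
  refine eq_zero_of_functional hπ hl fun k => ?_
  rw [map_sub, map_sub, ← Module.End.mul_apply, ← map_mul, key, key, sub_self]

theorem coind_apply_one_ne_zero {π' : Representation F H W}
    {f : Representation.coindV H.subtype π'} (hf : ∀ g ∉ H, f.1 g = 0) (h0 : f ≠ 0) :
    f.1 1 ≠ 0 := fun h => h0 (by rw [eq_coindSingle hf, h, map_zero])

/-- Every subrepresentation of the coinduced representation that contains a vector `f` contains
a vector invariant under `K`, nonzero if `f ≠ 0`. -/
theorem exists_invariant_mem (hKH : K ≤ H)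
    (hπ : π.IsIrreducible) {l : V →ₗ[F] W} (hl : l ≠ 0)
    (hlK : ∀ k (hk : k ∈ K) x, l (π ⟨k, hKH hk⟩ x) = l x)
    (p : G →* Q) (hp : p.ker ≤ K) (hc : (Nat.card p.range : F) ≠ 0)
    (hpπ : ∀ h : H, p h = 1 → π h = 1)
    (U : Submodule F (Representation.coindV H.subtype π))
    (hU : ∀ g, ∀ f ∈ U, Representation.coind H.subtype π g f ∈ U)
    {f : Representation.coindV H.subtype π} (hf : f ∈ U) (hf0 : f ≠ 0) :
    ∃ f' ∈ U, f' ≠ 0 ∧ ∀ k ∈ K, Representation.coind H.subtype π k f' = f' := by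
  obtain ⟨g, hg⟩ : ∃ g, f.1 g ≠ 0 := by
    by_contra! h
    exact hf0 (Subtype.ext (funext h))
  obtain ⟨h, hh⟩ : ∃ h : H, l (π h (f.1 g)) ≠ 0 := by
    by_contra! h
    exact hg (eq_zero_of_functional hπ hl h)
  obtain ⟨h, hm⟩ := h
  rw [← coind_apply_mul] at hh
  -- A translate of `f` whose value at 1 is not killed by `l`; averaging `f` itself over `K` might
  -- give zero.
  set f₁ := Representation.coind H.subtype π (h * g) f with hf₁
  have h1 : l (f₁.1 1) ≠ 0 := by rwa [hf₁, coind_val, one_mul]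
  have hcK : (Nat.card (p.comp K.subtype).range : F) ≠ 0 := by
    have hle : (p.comp K.subtype).range ≤ p.range := by
      rintro _ ⟨k, rfl⟩
      exact ⟨k, rfl⟩
    obtain ⟨m, hm⟩ := Subgroup.card_dvd_of_le hle
    intro h
    rw [hm, Nat.cast_mul, h, zero_mul] at hc
    exact hc rfl
  obtain ⟨y, hy, hyU⟩ := exists_average ((Representation.coind H.subtype π).comp K.subtype)
    (p.comp K.subtype) (fun k hk => by
      refine LinearMap.ext fun f => ?_
      ext x
      show f.1 (x * k) = f.1 x
      have hk1 : p k = 1 := hk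
      have hx : p (x * k * x⁻¹) = 1 := by simp [hk1]
      -- The kernel of `p` is normal and lies in `H`, so right translation by `k` becomes the
      -- trivial action of a conjugate of `k` through `π`.
      have : x * k = (x * k * x⁻¹) * x := by group
      rw [this, coind_apply_mul f (hKH (hp hx)), hpπ _ hx]
      rfl) hcK f₁
  refine ⟨y, ?_, ?_, fun k hk => hy ⟨k, hk⟩⟩
  · have := hyU U fun k => U.sub_mem (hU _ _ (hU _ _ hf)) (hU _ _ hf)
    simpa [hf₁] using U.add_mem this (hU (h * g) _ hf)
  · rintro rfl
    -- The functional f ↦ l(f(1)) is `K`-invariant, so averaging preserves its nonzero value at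
    -- `f₁`.
    have := hyU (LinearMap.ker (l ∘ₗ LinearMap.proj 1 ∘ₗ Submodule.subtype _)) fun k => by
      rw [LinearMap.mem_ker, map_sub, sub_eq_zero]
      show l (f₁.1 (1 * k)) = l (f₁.1 1)
      rw [one_mul, ← mul_one (k : G), coind_apply_mul f₁ (hKH k.2), hlK _ k.2]
    rw [LinearMap.mem_ker, zero_sub, map_neg, neg_eq_zero] at this
    exact h1 this

/-- A nonzero subrepresentation contains a nonzero `K`-invariant vector, which is supported on `H`.
The values at 1 of its elements supported on `H` form a nonzero subrepresentation of `π`, hence all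
of `V`, and their translates span. -/
theorem coind_isIrreducible [Finite (G ⧸ H)] (hKH : K ≤ H)
    (hC : ∀ g ∉ H, ∀ h ∈ H, ∃ k ∈ K, ∃ k' ∈ K, h * g = k * g * k')
    (hπ : π.IsIrreducible) (ht : ¬ π.IsTrivial) {l : V →ₗ[F] W} (hl : l ≠ 0)
    (hlK : ∀ k (hk : k ∈ K) x, l (π ⟨k, hKH hk⟩ x) = l x)
    (p : G →* Q) (hp : p.ker ≤ K) (hc : (Nat.card p.range : F) ≠ 0)
    (hpπ : ∀ h : H, p h = 1 → π h = 1) :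
    (Representation.coind H.subtype π).IsIrreducible := by
  have := nontrivial_of_irreducible hπ
  obtain ⟨x, hx⟩ := exists_ne (0 : V)
  have : Nontrivial (Representation.coindV H.subtype π) :=
    ⟨coindSingle H π x, 0, fun h => hx (by rw [← coindSingle_apply_one (π := π) x, h]; rfl)⟩
  refine isIrreducible_of_forall fun U hU f hf hf0 => ?_
  obtain ⟨f', hf', hf'0, hinv⟩ := exists_invariant_mem hKH hπ hl hlK p hp hc hpπ U hU hf hf0
  have hs : ∀ g ∉ H, f'.1 g = 0 := fun g hg =>
    coind_apply_eq_zero hKH hC hπ ht hl hlK hinv hg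
  refine coind_mem_of_coindSingle_mem U hU fun y => ?_
  refine mem_eq_top_of_irreducible hπ (U.comap (coindSingle H π)) (fun h x hx => ?_) (x := f'.1 1)
    ?_ (coind_apply_one_ne_zero hs hf'0) y
  · rw [Submodule.mem_comap, coindSingle_map]
    exact hU _ _ hx
  · rw [Submodule.mem_comap, ← eq_coindSingle hs]
    exact hf'

/-- The coinduced representation of a nontrivial representation has no vector invariant under
`H`. -/
theorem coind_eq_zero_of_invariant (hKH : K ≤ H)
    (hC : ∀ g ∉ H, ∀ h ∈ H, ∃ k ∈ K, ∃ k' ∈ K, h * g = k * g * k')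
    (hπ : π.IsIrreducible) (ht : ¬ π.IsTrivial) {l : V →ₗ[F] W} (hl : l ≠ 0)
    (hlK : ∀ k (hk : k ∈ K) x, l (π ⟨k, hKH hk⟩ x) = l x)
    {f : Representation.coindV H.subtype π}
    (hf : ∀ h ∈ H, Representation.coind H.subtype π h f = f) : f = 0 := by
  rw [eq_coindSingle fun g hg =>
    coind_apply_eq_zero hKH hC hπ ht hl hlK (fun k hk => hf k (hKH hk)) hg]
  rw [eq_zero_of_invariant hπ ht (x := f.1 1), map_zero]
  rintro ⟨h, hh⟩
  rw [← coind_apply_mul, mul_one]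
  conv_rhs => rw [← hf h hh, coind_val, one_mul]

/-- Nontrivial irreducible representations with isomorphic coinduced representations are
isomorphic. -/
theorem nonempty_equiv_of_coind (hKH : K ≤ H)
    (hC : ∀ g ∉ H, ∀ h ∈ H, ∃ k ∈ K, ∃ k' ∈ K, h * g = k * g * k')
    (hπ : π.IsIrreducible) (ht : ¬ π.IsTrivial) {l : V →ₗ[F] F} (hl : l ≠ 0)
    (hlK : ∀ k (hk : k ∈ K) x, l (π ⟨k, hKH hk⟩ x) = l x)
    (p : G →* Q) (hp : p.ker ≤ K) (hc : (Nat.card p.range : F) ≠ 0)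
    (hpπ : ∀ h : H, p h = 1 → π h = 1)
    {σ : Representation F H W} (hσ : σ.IsIrreducible) (ht' : ¬ σ.IsTrivial)
    {l' : W →ₗ[F] F} (hl' : l' ≠ 0) (hlK' : ∀ k (hk : k ∈ K) x, l' (σ ⟨k, hKH hk⟩ x) = l' x)
    (T : Representation.Equiv (Representation.coind H.subtype π)
      (Representation.coind H.subtype σ)) :
    Nonempty (Representation.Equiv π σ) := by
  have := nontrivial_of_irreducible hπ
  obtain ⟨x, hx⟩ := exists_ne (0 : V)
  have hne : coindSingle H π x ≠ 0 :=
    fun h => hx (by rw [← coindSingle_apply_one (π := π) x, h]; rfl)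
  obtain ⟨f, -, hf0, hinv⟩ := exists_invariant_mem hKH hπ hl hlK p hp hc hpπ ⊤
    (fun _ _ _ => trivial) (f := coindSingle H π x) trivial hne
  have hs : ∀ g ∉ H, f.1 g = 0 := fun g hg =>
    coind_apply_eq_zero hKH hC hπ ht hl hlK hinv hg
  have hTinv : ∀ k ∈ K, Representation.coind H.subtype σ k (T f) = T f := fun k hk => by
    have := T.toIntertwiningMap.isIntertwining _ _ k f
    rw [hinv k hk] at this
    exact this.symm
  have hTs : ∀ g ∉ H, (T f).1 g = 0 := fun g hg =>
    coind_apply_eq_zero hKH hC hσ ht' hl' hlK' hTinv hg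
  have hT0 : T f ≠ 0 := fun h => hf0 (T.injective (h.trans (map_zero T).symm))
  -- The corner of `T` between the vectors supported on `H`. It need not be injective a priori;
  -- being nonzero suffices by Schur's lemma, and the `K`-invariant vector `f` witnesses this.
  let j : Representation.IntertwiningMap π σ :=
    ⟨LinearMap.proj 1 ∘ₗ Submodule.subtype _ ∘ₗ T.toLinearMap ∘ₗ coindSingle H π, fun h => by
      refine LinearMap.ext fun x => ?_
      show (T (coindSingle H π (π h x))).1 1 = σ h ((T (coindSingle H π x)).1 1)
      rw [coindSingle_map h.1 h.2]
      have := T.toIntertwiningMap.isIntertwining _ _ h (coindSingle H π x)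
      refine (congrArg (fun f => f.1 1) this).trans ?_
      show (T (coindSingle H π x)).1 (1 * h) = _
      rw [one_mul, ← mul_one (h : G), coind_apply_mul _ h.2]⟩
  rcases Representation.IsIrreducible.bijective_or_eq_zero j with h | h
  · exact ⟨Representation.IntertwiningMap.ofBijective j h⟩
  · exfalso
    refine coind_apply_one_ne_zero hTs hT0 ?_
    have : j (f.1 1) = 0 := by rw [h]; rfl
    rw [← this]
    show _ = (T (coindSingle H π (f.1 1))).1 1
    rw [← eq_coindSingle hs]

end Abstract

/-! ### Complete reducibility -/

section Semisimple

variable {F : Type u} {H W Q : Type*} [Field F] [Group H] [AddCommGroup W] [Module F W]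
  [Group Q] [Finite Q]

/-- Maschke's theorem for a group that acts through a finite group of invertible order. -/
theorem exists_equivariant_projection (θ : Representation F H W) (p : H →* Q)
    (hp : ∀ h, p h = 1 → θ h = 1) (hc : (Nat.card p.range : F) ≠ 0) (U : Submodule F W)
    (hU : ∀ h, ∀ x ∈ U, θ h x ∈ U) :
    ∃ q : W →ₗ[F] W, (∀ h x, q (θ h x) = θ h (q x)) ∧ (∀ x, q x ∈ U) ∧ ∀ x ∈ U, q x = x := by
  obtain ⟨q₀, hq₀⟩ := U.subtype.exists_leftInverse_of_injective (LinearMap.ker_eq_bot.2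
    Subtype.val_injective)
  have hq₀' : ∀ x (hx : x ∈ U), q₀ x = ⟨x, hx⟩ := fun x hx => LinearMap.congr_fun hq₀ ⟨x, hx⟩
  -- An arbitrary linear projection onto `U`, to be averaged under conjugation. Each heh⁻¹ − e maps
  -- into `U` and vanishes on `U`; both properties pass to the average.
  let e := U.subtype ∘ₗ q₀
  have heU : ∀ x, e x ∈ U := fun x => (q₀ x).2
  have hee : ∀ x ∈ U, e x = x := fun x hx => congrArg Subtype.val (hq₀' x hx)
  obtain ⟨q, hq, hqU⟩ := exists_average (Representation.linHom θ θ) p (fun h hh => by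
    have h1 : θ h⁻¹ = 1 := hp _ (by rw [map_inv, hh, inv_one])
    refine LinearMap.ext fun f => LinearMap.ext fun x => ?_
    simp [hp h hh, h1]) hc e
  have happ : ∀ h x, Representation.linHom θ θ h e x = θ h (e (θ h⁻¹ x)) := fun h x => rfl
  have h1 : ∀ x, (q - e) x ∈ U := fun x => by
    refine hqU (U.comap (LinearMap.applyₗ x)) fun h => ?_
    show (Representation.linHom θ θ h e - e) x ∈ U
    rw [LinearMap.sub_apply, happ]
    exact U.sub_mem (hU _ _ (heU _)) (heU _)
  have h2 : ∀ x ∈ U, (q - e) x = 0 := fun x hx => by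
    refine LinearMap.mem_ker.1 (?_ : q - e ∈ LinearMap.ker (LinearMap.applyₗ x : (W →ₗ[F] W) →ₗ[F] W))
    refine hqU _ fun h => ?_
    rw [LinearMap.mem_ker]
    show (Representation.linHom θ θ h e - e) x = 0
    rw [LinearMap.sub_apply, happ, hee x hx, hee _ (hU _ _ hx), ← Module.End.mul_apply, ← map_mul,
      mul_inv_cancel, map_one, Module.End.one_apply, sub_self]
  refine ⟨q, fun h x => ?_, fun x => ?_, fun x hx => ?_⟩
  · have := LinearMap.congr_fun (hq h) (θ h x)
    rw [← this]
    show θ h (q (θ h⁻¹ (θ h x))) = _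
    rw [← Module.End.mul_apply (θ h⁻¹), ← map_mul, inv_mul_cancel, map_one, Module.End.one_apply]
  · have := U.add_mem (h1 x) (heU x)
    rwa [LinearMap.sub_apply, sub_add_cancel] at this
  · have := h2 x hx
    rw [LinearMap.sub_apply, sub_eq_zero] at this
    rw [this, hee x hx]

/-- An irreducible direct summand of a representation, on a coordinate space. -/
structure IrreducibleSummand (θ : Representation F H W) where
  dim : ℕ
  rep : Representation F H (Fin dim → F)
  irreducible : rep.IsIrreducible
  incl : Representation.IntertwiningMap rep θ
  proj : Representation.IntertwiningMap θ rep
  proj_incl : ∀ x, proj (incl x) = x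

/-- A nonzero subrepresentation of least dimension is irreducible. -/
theorem exists_irreducible_submodule [FiniteDimensional F W] [Nontrivial W]
    (θ : Representation F H W) :
    ∃ S : Subrepresentation θ, S.toRepresentation.IsIrreducible := by
  have hex : ∃ n : ℕ, ∃ S : Subrepresentation θ, S.toSubmodule ≠ ⊥ ∧
      Module.finrank F S.toSubmodule = n := ⟨_, ⊤, top_ne_bot (α := Submodule F W), rfl⟩
  classical
  obtain ⟨S, hS, hn⟩ := Nat.find_spec hex
  refine ⟨S, ?_⟩
  have : Nontrivial S.toSubmodule := Submodule.nontrivial_iff_ne_bot.2 hS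
  refine isIrreducible_of_forall fun U hU x hx hx0 y => ?_
  let U' : Subrepresentation θ := ⟨U.map S.toSubmodule.subtype, by
    rintro h _ ⟨z, hz, rfl⟩
    exact ⟨_, hU h z hz, rfl⟩⟩
  have hle : U'.toSubmodule ≤ S.toSubmodule := by
    rintro _ ⟨z, -, rfl⟩
    exact z.2
  have hne : U'.toSubmodule ≠ ⊥ := by
    intro h
    have : (x : W) ∈ U'.toSubmodule := ⟨x, hx, rfl⟩
    rw [h, Submodule.mem_bot] at this
    exact hx0 (Subtype.ext this)
  have heq : U'.toSubmodule = S.toSubmodule :=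
    Submodule.eq_of_le_of_finrank_le hle
      (hn.le.trans (Nat.find_min' hex ⟨U', hne, rfl⟩))
  have hy : (y : W) ∈ U'.toSubmodule := by
    rw [heq]
    exact y.2
  obtain ⟨z, hz, e⟩ := hy
  rwa [← Subtype.ext (a1 := z) (a2 := y) e]

theorem isIrreducible_of_equiv {V V' : Type*} [AddCommGroup V] [Module F V] [AddCommGroup V']
    [Module F V'] {π : Representation F H V} {π' : Representation F H V'}
    (hπ : π.IsIrreducible) (e : Representation.Equiv π π') : π'.IsIrreducible := by
  have := nontrivial_of_irreducible hπ
  have : Nontrivial V' := e.injective.nontrivial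
  have he : ∀ h x, e (π h x) = π' h (e x) := e.toIntertwiningMap.isIntertwining _ _
  refine isIrreducible_of_forall fun U hU x hx hx0 y => ?_
  obtain ⟨x, rfl⟩ := e.surjective x
  obtain ⟨y, rfl⟩ := e.surjective y
  refine mem_eq_top_of_irreducible hπ (U.comap e.toLinearMap) (fun h z hz => ?_) (x := x) hx
    (fun h => hx0 (by rw [h, map_zero])) y
  show e (π h z) ∈ U
  rw [he]
  exact hU h _ hz

/-- Transport of structure to a coordinate space. -/
theorem exists_coordinate_equiv {V : Type*} [AddCommGroup V] [Module F V] [FiniteDimensional F V]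
    (π : Representation F H V) :
    ∃ (n : ℕ) (π' : Representation F H (Fin n → F)), Nonempty (Representation.Equiv π π') := by
  let b := (Module.finBasis F V).equivFun
  refine ⟨_, b.conjRingEquiv.toMonoidHom.comp π, ⟨Representation.Equiv.mk b fun h => ?_⟩⟩
  refine LinearMap.ext fun x => ?_
  show b (π h x) = b (π h (b.symm (b x)))
  rw [b.symm_apply_apply]

/-- Split off an irreducible subrepresentation and pass to the kernel of an equivariant projection
onto it, by induction on the dimension. Coordinate spaces keep the summands in the universe of `F`,
as `Constituent` demands. -/
theorem exists_decomposition (p : H →* Q) (hc : (Nat.card p.range : F) ≠ 0) :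
    ∀ (n : ℕ) {W : Type w} [AddCommGroup W] [Module F W] [FiniteDimensional F W]
      (θ : Representation F H W), (∀ h, p h = 1 → θ h = 1) → Module.finrank F W = n →
      ∃ (I : Type) (_ : Fintype I) (P : I → IrreducibleSummand θ),
        (∀ i j, i ≠ j → ∀ x, (P i).proj ((P j).incl x) = 0) ∧
        ∀ x, ∑ i, (P i).incl ((P i).proj x) = x := by
  intro n
  induction n using Nat.strong_induction_on with
  | _ n ih =>
    intro W _ _ _ θ hp hn
    rcases subsingleton_or_nontrivial W with hW | hW
    · exact ⟨Empty, inferInstance, fun i => i.elim, fun i => i.elim, fun x => Subsingleton.elim _ _⟩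
    obtain ⟨S, hS⟩ := exists_irreducible_submodule θ
    have := nontrivial_of_irreducible hS
    obtain ⟨q, hq, hqS, hqS'⟩ := exists_equivariant_projection θ p hp hc S.toSubmodule
      fun h x hx => S.apply_mem_toSubmodule h hx
    obtain ⟨d, σ, ⟨e⟩⟩ := exists_coordinate_equiv S.toRepresentation
    have he : ∀ h x, e (S.toRepresentation h x) = σ h (e x) :=
      e.toIntertwiningMap.isIntertwining _ _
    have he' : ∀ h x, e.symm (σ h x) = S.toRepresentation h (e.symm x) :=
      e.symm.toIntertwiningMap.isIntertwining _ _
    let C : Subrepresentation θ := ⟨LinearMap.ker q, fun h x hx => by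
      rw [LinearMap.mem_ker] at hx ⊢
      rw [hq, hx, map_zero]⟩
    let P₀ : IrreducibleSummand θ :=
      { dim := d
        rep := σ
        irreducible := isIrreducible_of_equiv hS e
        incl := ⟨S.toSubmodule.subtype ∘ₗ e.symm.toLinearMap, fun h => LinearMap.ext fun x =>
          congrArg Subtype.val (he' h x)⟩
        proj := ⟨e.toLinearMap ∘ₗ q.codRestrict S.toSubmodule hqS, fun h => LinearMap.ext fun x =>
          (congrArg e (Subtype.ext (hq h x))).trans (he h _)⟩
        proj_incl := fun x =>
          (congrArg e (Subtype.ext (hqS' _ (e.symm x).2))).trans (e.apply_symm_apply x) }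
    have hP₀ : ∀ x, P₀.incl (P₀.proj x) = q x := fun x =>
      congrArg Subtype.val (e.symm_apply_apply (q.codRestrict S.toSubmodule hqS x))
    have hlt : Module.finrank F C.toSubmodule < n := by
      rw [← hn]
      refine Submodule.finrank_lt fun h => ?_
      obtain ⟨x, hx⟩ := exists_ne (0 : S.toSubmodule)
      have h1 : (x : W) ∈ C.toSubmodule := h ▸ Submodule.mem_top
      have h2 : q x = 0 := h1
      rw [hqS' _ x.2] at h2
      exact hx (Subtype.ext h2)
    obtain ⟨I, hI, P, hP, hsum⟩ := ih _ hlt C.toRepresentation (fun h hh =>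
      LinearMap.ext fun x => Subtype.ext (LinearMap.congr_fun (hp h hh) x)) rfl
    have hr : ∀ x, (LinearMap.id - q : W →ₗ[F] W) x ∈ C.toSubmodule := fun x => by
      show q (x - q x) = 0
      rw [map_sub, hqS' _ (hqS x), sub_self]
    let r : Representation.IntertwiningMap θ C.toRepresentation :=
      ⟨(LinearMap.id - q).codRestrict C.toSubmodule hr, fun h => LinearMap.ext fun x =>
        Subtype.ext (by
          show θ h x - q (θ h x) = θ h (x - q x)
          rw [hq, map_sub])⟩
    let j : Representation.IntertwiningMap C.toRepresentation θ :=
      ⟨C.toSubmodule.subtype, fun h => rfl⟩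
    have hrj : ∀ x, r (j x) = x := fun x => Subtype.ext (by
      show (x : W) - q x = x
      rw [show q x = 0 from x.2, sub_zero])
    have hqj : ∀ x, q (j x) = 0 := fun x => x.2
    let P' : I → IrreducibleSummand θ := fun i =>
      { dim := (P i).dim
        rep := (P i).rep
        irreducible := (P i).irreducible
        incl := j.comp (P i).incl
        proj := (P i).proj.comp r
        proj_incl := fun x => by
          rw [Representation.IntertwiningMap.comp_apply, Representation.IntertwiningMap.comp_apply,
            hrj, (P i).proj_incl] }
    have h0 : ∀ i x, (P' i).proj (P₀.incl x) = 0 := fun i x => by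
      show (P i).proj (r (P₀.incl x)) = 0
      rw [show r (P₀.incl x) = 0 from Subtype.ext ?_, map_zero]
      show P₀.incl x - q (P₀.incl x) = 0
      rw [← hP₀, P₀.proj_incl, sub_self]
    have h1 : ∀ i x, P₀.proj ((P' i).incl x) = 0 := fun i x => by
      show e (q.codRestrict S.toSubmodule hqS (j ((P i).incl x))) = 0
      rw [show q.codRestrict S.toSubmodule hqS (j ((P i).incl x)) = 0 from
        Subtype.ext (hqj _), map_zero]
    have h2 : ∀ i k, i ≠ k → ∀ x, (P' i).proj ((P' k).incl x) = 0 := fun i k hik x => by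
      show (P i).proj (r (j ((P k).incl x))) = 0
      rw [hrj, hP i k hik]
    refine ⟨Option I, inferInstance, fun i => i.elim P₀ P', ?_, fun x => ?_⟩
    · rintro (_ | i) (_ | k) hik x
      · exact absurd rfl hik
      · exact h1 k x
      · exact h0 i x
      · exact h2 i k (fun h => hik (congrArg some h)) x
    · rw [Fintype.sum_option]
      show P₀.incl (P₀.proj x) + ∑ i, j ((P i).incl ((P i).proj (r x))) = x
      rw [hP₀, ← map_sum, hsum]
      exact add_sub_cancel _ _

end Semisimple

/-! ### Multiplicities in direct sums -/

section Multiplicity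

variable {F : Type u} {H V W : Type*} [Field F] [Group H] [AddCommGroup V] [Module F V]
  [AddCommGroup W] [Module F W]

/-- The intertwining map on a direct sum given by intertwining maps on the summands. -/
noncomputable def directSumLift {I : Type*} [DecidableEq I] {M : I → Type*}
    [∀ i, AddCommGroup (M i)] [∀ i, Module F (M i)] {ρ : ∀ i, Representation F H (M i)}
    {θ : Representation F H W} (f : ∀ i, Representation.IntertwiningMap (ρ i) θ) :
    Representation.IntertwiningMap (Representation.directSum ρ) θ :=
  ⟨DirectSum.toModule F I W fun i => (f i).toLinearMap, fun h => by
    refine DirectSum.linearMap_ext F fun i => LinearMap.ext fun x => ?_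
    simp only [LinearMap.comp_apply, Representation.directSum_apply, DirectSum.lmap_lof,
      DirectSum.toModule_lof]
    exact (f i).isIntertwining _ _ h x⟩

theorem directSumLift_lof {I : Type*} [DecidableEq I] {M : I → Type*}
    [∀ i, AddCommGroup (M i)] [∀ i, Module F (M i)] {ρ : ∀ i, Representation F H (M i)}
    {θ : Representation F H W} (f : ∀ i, Representation.IntertwiningMap (ρ i) θ) (i : I) (x : M i) :
    directSumLift f (DirectSum.lof F I M i x) = f i x :=
  DirectSum.toModule_lof F i x

/-- The inclusion of a summand. -/
noncomputable def directSumIncl {I : Type*} [DecidableEq I] {M : I → Type*}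
    [∀ i, AddCommGroup (M i)] [∀ i, Module F (M i)] (ρ : ∀ i, Representation F H (M i)) (i : I) :
    Representation.IntertwiningMap (ρ i) (Representation.directSum ρ) :=
  ⟨DirectSum.lof F I M i, fun h => LinearMap.ext fun x => by simp⟩

/-- An intertwining map on a direct sum is injective if it has compatible left inverses on the
summands. -/
theorem directSumLift_injective {I : Type*} [DecidableEq I] {M : I → Type*}
    [∀ i, AddCommGroup (M i)] [∀ i, Module F (M i)] {ρ : ∀ i, Representation F H (M i)}
    {θ : Representation F H W} (f : ∀ i, Representation.IntertwiningMap (ρ i) θ)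
    (q : ∀ i, Representation.IntertwiningMap θ (ρ i)) (h1 : ∀ i x, q i (f i x) = x)
    (h2 : ∀ i j, i ≠ j → ∀ x, q i (f j x) = 0) : Function.Injective (directSumLift f) := by
  have key : ∀ i x, q i (directSumLift f x) = x i := fun i x => by
    have : (q i).toLinearMap ∘ₗ (directSumLift f).toLinearMap = DirectSum.component F I M i := by
      refine DirectSum.linearMap_ext F fun j => LinearMap.ext fun y => ?_
      show q i (directSumLift f (DirectSum.lof F I M j y)) =
        DirectSum.component F I M i (DirectSum.lof F I M j y)
      rw [directSumLift_lof]
      by_cases hij : i = j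
      · subst hij
        rw [h1, DirectSum.component.lof_self]
      · rw [h2 i j hij, DirectSum.component.of, dif_neg (Ne.symm hij)]
    exact LinearMap.congr_fun this x
  intro x y hxy
  refine DFinsupp.ext fun i => ?_
  rw [← key, ← key, hxy]

variable {π : Representation F H V} {θ : Representation F H W}

theorem exists_injective_of_mult_ne_zero (h : mult π θ ≠ 0) :
    ∃ f : Representation.IntertwiningMap π θ, Function.Injective f := by
  by_contra hne
  apply h
  refine Nat.le_zero.1 (csSup_le' ?_)
  rintro k ⟨f, hf⟩
  by_contra hk
  refine hne ⟨f.comp (directSumIncl (fun _ : Fin k => π) ⟨0, by omega⟩), hf.comp ?_⟩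
  exact DirectSum.of_injective _

/-- By Schur's lemma an embedding of k copies of `π` has no component in the summands not isomorphic
to `π`, so comparing dimensions bounds k; the inclusions of the isomorphic summands attain the
bound. Counting dimensions of spaces rather than of Hom spaces avoids any assumption that `F` is a
splitting field. -/
theorem mult_eq_card (hπ : π.IsIrreducible) [FiniteDimensional F W] {I : Type} [Fintype I]
    (P : I → IrreducibleSummand θ)
    (hP : ∀ i j, i ≠ j → ∀ x, (P i).proj ((P j).incl x) = 0)
    (hsum : ∀ x, ∑ i, (P i).incl ((P i).proj x) = x) :
    mult π θ = Nat.card {i // Nonempty (Representation.Equiv π (P i).rep)} := by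
  classical
  rw [Nat.card_eq_fintype_card]
  have hle : ∀ k ∈ {k : ℕ | ∃ f : Representation.IntertwiningMap
      (Representation.directSum fun _ : Fin k => π) θ, Function.Injective f},
      k ≤ Fintype.card {i // Nonempty (Representation.Equiv π (P i).rep)} := by
    rintro k ⟨f, hf⟩
    rcases Nat.eq_zero_or_pos k with rfl | hk
    · exact Nat.zero_le _
    have hfin : FiniteDimensional F V := FiniteDimensional.of_injective
      (f.comp (directSumIncl (fun _ : Fin k => π) ⟨0, hk⟩)).toLinearMap
      (hf.comp (DirectSum.of_injective _))
    have hzero : ∀ i, ¬ Nonempty (Representation.Equiv π (P i).rep) → ∀ x, (P i).proj (f x) = 0 := by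
      intro i hi x
      have : (P i).proj.toLinearMap ∘ₗ f.toLinearMap = 0 := by
        refine DirectSum.linearMap_ext F fun j => LinearMap.ext fun y => ?_
        have := (P i).irreducible
        rcases Representation.IsIrreducible.bijective_or_eq_zero
          (((P i).proj.comp f).comp (directSumIncl (fun _ : Fin k => π) j)) with h | h
        · exact absurd ⟨Representation.IntertwiningMap.ofBijective _ h⟩ hi
        · exact congrArg (fun f : Representation.IntertwiningMap π (P i).rep => f y) h
      exact LinearMap.congr_fun this x
    let g : (DirectSum (Fin k) fun _ => V) →ₗ[F]
        ∀ i : {i // Nonempty (Representation.Equiv π (P i).rep)}, Fin (P i).dim → F :=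
      LinearMap.pi fun i => (P i).proj.toLinearMap ∘ₗ f.toLinearMap
    have hg : Function.Injective g := by
      refine (injective_iff_map_eq_zero g).2 fun x hx => hf ?_
      rw [map_zero, ← hsum (f x)]
      refine Finset.sum_eq_zero fun i _ => ?_
      by_cases hi : Nonempty (Representation.Equiv π (P i).rep)
      · rw [show (P i).proj (f x) = 0 from congrFun hx ⟨i, hi⟩, map_zero]
      · rw [hzero i hi, map_zero]
    have hd := LinearMap.finrank_le_finrank_of_injective hg
    have hfr : ∀ i : {i // Nonempty (Representation.Equiv π (P i).rep)},
        Module.finrank F (Fin (P i).dim → F) = Module.finrank F V :=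
      fun i => (LinearEquiv.finrank_eq i.2.some.toLinearEquiv).symm
    rw [Module.finrank_directSum, Module.finrank_pi_fintype,
      Finset.sum_congr rfl fun i _ => hfr i] at hd
    simp only [Finset.sum_const, Finset.card_univ, Fintype.card_fin, smul_eq_mul] at hd
    have := nontrivial_of_irreducible hπ
    exact Nat.le_of_mul_le_mul_right hd Module.finrank_pos
  refine le_antisymm (csSup_le' hle) (le_csSup ⟨_, hle⟩ ?_)
  let σ := (Fintype.equivFin {i // Nonempty (Representation.Equiv π (P i).rep)}).symm
  refine ⟨directSumLift fun j => (P (σ j)).incl.comp (σ j).2.some.toIntertwiningMap,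
    directSumLift_injective _ (fun j => (σ j).2.some.symm.toIntertwiningMap.comp (P (σ j)).proj)
      (fun i x => ?_) (fun i j hij x => ?_)⟩
  · show (σ i).2.some.symm ((P (σ i)).proj ((P (σ i)).incl ((σ i).2.some x))) = x
    rw [(P (σ i)).proj_incl]
    exact (σ i).2.some.symm_apply_apply x
  · show (σ i).2.some.symm ((P (σ i)).proj ((P (σ j)).incl ((σ j).2.some x))) = 0
    rw [hP _ _ fun h => hij (σ.injective (Subtype.ext h)), map_zero]

end Multiplicity

/-! ### Nontrivial constituents of the representation on the descendants -/

section Constituents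

variable {F : Type u} [Field F] {X : ℕ → Type v} {G : Subgroup (rootedAut X)} {a : Vertex X}
  {Q : Type*} [Group Q] [Finite Q]

/-- The permutation representation on the descendants is the direct sum of its nontrivial
irreducible constituents, with their multiplicities, and its invariants. -/
theorem exists_constituent_decomposition
    [FiniteDimensional F (MonoidAlgebra F (descendants a))] (p : St G a →* Q)
    (hp : ∀ h, p h = 1 → descRep F G a h = 1) (hc : (Nat.card p.range : F) ≠ 0) :
    ∃ (ι : ∀ s : (Σ c : Irr₀ F G a, Fin c.mult),
        Representation.IntertwiningMap s.1.out.rep (descRep F G a))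
      (q : ∀ s : (Σ c : Irr₀ F G a, Fin c.mult),
        Representation.IntertwiningMap (descRep F G a) s.1.out.rep),
      (∀ s x, q s (ι s x) = x) ∧ (∀ s t, s ≠ t → ∀ x, q s (ι t x) = 0) ∧
      ∀ U : Submodule F (MonoidAlgebra F (descendants a)), (∀ s x, ι s x ∈ U) →
        (∀ z, (∀ h, descRep F G a h z = z) → z ∈ U) → ∀ z, z ∈ U := by
  classical
  obtain ⟨I, _, P, hP, hsum⟩ := exists_decomposition p hc _ (descRep F G a) hp rfl
  let A : Irr₀ F G a → Type := fun c => {i // Nonempty (Representation.Equiv c.out.rep (P i).rep)}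
  have hm : ∀ c : Irr₀ F G a, c.mult = Nat.card (A c) := fun c =>
    mult_eq_card c.out.isConstituent.irreducible P hP hsum
  let σ : ∀ c : Irr₀ F G a, Fin c.mult ≃ A c := fun c =>
    (finCongr (hm c)).trans (Finite.equivFin (A c)).symm
  -- A summand isomorphic to the representatives of two classes forces the classes to coincide.
  have hσ : ∀ s t : (Σ c : Irr₀ F G a, Fin c.mult), s ≠ t →
      (σ s.1 s.2).1 ≠ (σ t.1 t.2).1 := by
    rintro ⟨c, j⟩ ⟨d, k⟩ hst h
    apply hst
    obtain rfl : c = d := by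
      refine Quotient.out_equiv_out.1 ⟨((σ c j).2.some).trans ?_⟩
      have e := (σ d k).2.some.symm
      dsimp only at h
      rw [← h] at e
      exact e
    exact congrArg (Sigma.mk c) ((σ c).injective (Subtype.ext h))
  refine ⟨fun s => (P (σ s.1 s.2).1).incl.comp (σ s.1 s.2).2.some.toIntertwiningMap,
    fun s => (σ s.1 s.2).2.some.symm.toIntertwiningMap.comp (P (σ s.1 s.2).1).proj,
    fun s x => ?_, fun s t hst x => ?_, fun U h1 h2 z => ?_⟩
  · show (σ s.1 s.2).2.some.symm ((P (σ s.1 s.2).1).proj ((P (σ s.1 s.2).1).incl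
      ((σ s.1 s.2).2.some x))) = x
    rw [(P (σ s.1 s.2).1).proj_incl]
    exact (σ s.1 s.2).2.some.symm_apply_apply x
  · show (σ s.1 s.2).2.some.symm ((P (σ s.1 s.2).1).proj ((P (σ t.1 t.2).1).incl
      ((σ t.1 t.2).2.some x))) = 0
    rw [hP _ _ (hσ s t hst), map_zero]
  · rw [← hsum z]
    refine U.sum_mem fun i _ => ?_
    -- A trivial summand consists of invariant vectors; a nontrivial one defines a class in `Irr₀`
    -- and is therefore enumerated by `σ`.
    by_cases ht : (P i).rep.IsTrivial
    · refine h2 _ fun h => ?_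
      rw [← (P i).incl.isIntertwining, Representation.isTrivial_apply]
    · have hirr := (P i).irreducible
      have hocc : mult (P i).rep (descRep F G a) ≠ 0 := by
        rw [mult_eq_card hirr P hP hsum]
        have : Nonempty {k // Nonempty (Representation.Equiv (P i).rep (P k).rep)} :=
          ⟨⟨i, ⟨Representation.Equiv.refl _⟩⟩⟩
        exact Nat.card_pos.ne'
      let C : Constituent F G a := ⟨_, (P i).rep, ⟨hirr, ht, hocc⟩⟩
      let c : Irr₀ F G a := Quotient.mk _ C
      have hi : Nonempty (Representation.Equiv c.out.rep (P i).rep) :=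
        Quotient.mk_out (s := Constituent.setoid F G a) C
      obtain ⟨j, hj⟩ := (σ c).surjective ⟨i, hi⟩
      have := h1 ⟨c, j⟩ ((σ c j).2.some.symm ((P (σ c j).1).proj z))
      have e : ∀ x, (σ c j).2.some ((σ c j).2.some.symm x) = x :=
        (σ c j).2.some.apply_symm_apply
      change (P (σ c j).1).incl ((σ c j).2.some ((σ c j).2.some.symm _)) ∈ U at this
      rw [e] at this
      have hj' : (σ c j).1 = i := congrArg Subtype.val hj
      rwa [hj'] at this

end Constituents

/-! ### Finite levels, vertex stabilisers and cylinder sets -/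

section Tree

variable {X : ℕ → Type v}

theorem word_congr {a b : Vertex X} (h : a = b) {i : ℕ} (ha : i < a.level) (hb : i < b.level) :
    a.word ⟨i, ha⟩ = b.word ⟨i, hb⟩ := by
  subst h
  rfl

/-! ### Levels -/

/-- The vertices of level `n`. -/
abbrev Level (X : ℕ → Type v) (n : ℕ) : Type v := {b : Vertex X // b.level = n}

instance [∀ i, Finite (X i)] (n : ℕ) : Finite (Level X n) := by
  refine Finite.of_injective (β := (i : Fin n) → X i)
    (fun b i => b.1.word ⟨i, by rw [b.2]; exact i.2⟩) fun b c h => Subtype.ext ?_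
  refine vertex_ext (b.2.trans c.2.symm) fun i hb hc => ?_
  exact congrFun h ⟨i, by rw [← b.2]; exact hb⟩

instance (n : ℕ) : MulAction (rootedAut X) (Level X n) where
  smul g b := ⟨g • b.1, (smul_level g b.1).trans b.2⟩
  one_smul b := Subtype.ext (one_smul _ b.1)
  mul_smul g h b := Subtype.ext (mul_smul g h b.1)

/-- The action on a level. -/
def levelPerm (X : ℕ → Type v) (n : ℕ) : rootedAut X →* Equiv.Perm (Level X n) :=
  MulAction.toPermHom (rootedAut X) (Level X n)

theorem levelPerm_eq_one_iff {n : ℕ} {g : rootedAut X} :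
    levelPerm X n g = 1 ↔ ∀ b : Vertex X, b.level = n → g • b = b := by
  constructor
  · intro h b hb
    exact congrArg Subtype.val (Equiv.congr_fun h (⟨b, hb⟩ : Level X n))
  · intro h
    exact Equiv.ext fun b => Subtype.ext (h b.1 b.2)

/-- The order of the finite group induced by `G` on a level is invertible. -/
theorem card_levelPerm_ne_zero {F : Type*} [Field F] [∀ i, Finite (X i)]
    {G : Subgroup (rootedAut X)} (hF : CharNotDvdSteinitzOrder F G.topologicalClosure) (n : ℕ) :
    (Nat.card ((levelPerm X n).comp G.subtype).range : F) ≠ 0 := by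
  let ψ := (levelPerm X n).comp G.topologicalClosure.subtype
  have hopen : IsOpen (ψ.ker : Set G.topologicalClosure) := by
    have : (ψ.ker : Set G.topologicalClosure) =
        ⋂ b : Level X n, Subtype.val ⁻¹' {g : rootedAut X | g • b.1 = b.1} := by
      ext g
      rw [SetLike.mem_coe, MonoidHom.mem_ker, Set.mem_iInter]
      exact levelPerm_eq_one_iff.trans ⟨fun h b => h b.1 b.2, fun h b hb => h ⟨b, hb⟩⟩
    rw [this]
    exact isOpen_iInter_of_finite fun b => (isOpen_smul_eq b.1 b.1).preimage continuous_subtype_val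
  let N : OpenNormalSubgroup G.topologicalClosure :=
    { toSubgroup := ψ.ker
      isOpen' := hopen
      isNormal' := inferInstance }
  have e : G.topologicalClosure ⧸ ψ.ker ≃* ψ.range := QuotientGroup.quotientKerEquivRange ψ
  have hfin : Finite (G.topologicalClosure ⧸ N.toSubgroup) := Finite.of_equiv _ e.symm.toEquiv
  have h1 := hF N hfin
  rw [show Nat.card (G.topologicalClosure ⧸ N.toSubgroup) = Nat.card ψ.range from
    Nat.card_congr e.toEquiv] at h1
  intro h
  -- The image of `G` is a subgroup of the image of its closure, so Lagrange's theorem suffices and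
  -- density is not needed.
  refine h1 (((ringChar.spec F _).1 h).trans (Subgroup.card_dvd_of_le ?_))
  rintro _ ⟨g, rfl⟩
  exact ⟨⟨g.1, G.le_topologicalClosure g.2⟩, rfl⟩

/-! ### Descendants -/

theorem mem_descendants {a b : Vertex X} : b ∈ descendants a ↔ IsChild a b := by
  refine ⟨fun h => h.1.resolve_right fun h' => ?_, fun h => ⟨Or.inl h, h.1⟩⟩
  have := h'.1
  have := h.2
  omega

theorem exists_mem_descendants [∀ i, Nontrivial (X i)] (a : Vertex X) : ∃ b, b ∈ descendants a := by
  classical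
  refine ⟨⟨a.level + 1, fun i => if h : (i : ℕ) < a.level then a.word ⟨i, h⟩ else
    Classical.arbitrary _⟩, mem_descendants.2 ⟨rfl, fun i ha _ => ?_⟩⟩
  simp [ha]

instance [∀ i, Finite (X i)] (a : Vertex X) : Finite (descendants a) :=
  Finite.of_injective (β := Level X (a.level + 1)) (fun b => ⟨b.1, b.2.2⟩)
    fun _ _ h => Subtype.ext (congrArg (fun b : Level X _ => b.1) h)

theorem pre_eq_of_mem {a b : Vertex X} (h : b ∈ descendants a) {m : ℕ} (hm : m ≤ a.level)
    (hm' : m ≤ b.level) : pre b m hm' = pre a m hm := by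
  refine vertex_ext rfl fun i hi _ => ?_
  exact ((mem_descendants.1 h).2 i (lt_of_lt_of_le hi hm) (lt_of_lt_of_le hi hm')).symm

theorem smul_eq_of_mem_descendants {a b c : Vertex X} (g : rootedAut X) (hb : b ∈ descendants a)
    (hc : c ∈ descendants a) (h : g • b = c) : g • a = a := by
  have h1 := smul_mem_descendants g hb
  rw [h] at h1
  exact parent_unique (mem_descendants.1 h1) (mem_descendants.1 hc)

variable {G : Subgroup (rootedAut X)}

theorem exists_smul_eq (hG : IsSphericallyTransitive G) {a b : Vertex X} (h : a.level = b.level) :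
    ∃ g : G, g • a = b := by
  obtain ⟨g, hg, e⟩ := hG a b h
  exact ⟨⟨g, hg⟩, e⟩

/-- The stabiliser of a vertex is transitive on its descendants. -/
theorem exists_stabilizer_smul_eq (hG : IsSphericallyTransitive G) {a : Vertex X}
    (b c : descendants a) : ∃ h : St G a, h • b = c := by
  obtain ⟨g, hg⟩ := exists_smul_eq hG (a := b.1) (b := c.1) (by rw [b.2.2, c.2.2])
  exact ⟨⟨g, smul_eq_of_mem_descendants g.1 b.2 c.2 hg⟩, Subtype.ext hg⟩

theorem stabilizer_le {a b : Vertex X} (hb : b ∈ descendants a) : St G b ≤ St G a :=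
  fun g hg => smul_eq_of_mem_descendants g.1 hb hb hg

/-- Local `2`-transitivity in terms of double cosets. -/
theorem exists_double_coset (hG : IsLocallyTwoTransitive G) {a b : Vertex X}
    (hb : b ∈ descendants a) (g : G) (hg : g ∉ St G a) (h : G) (hh : h ∈ St G a) :
    ∃ k ∈ St G b, ∃ k' ∈ St G b, h * g = k * g * k' := by
  have hne : a ≠ g⁻¹ • a := fun e => hg (by
    rw [MulAction.mem_stabilizer_iff]
    nth_rewrite 1 [e]
    rw [smul_inv_smul])
  have h1 : g⁻¹ • b ∈ descendants (g⁻¹ • a) := smul_mem_descendants (g⁻¹ : G).1 hb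
  have h2 : (h * g)⁻¹ • b ∈ descendants (g⁻¹ • a) := by
    have := smul_mem_descendants ((h * g)⁻¹ : G).1 hb
    have e : ((h * g)⁻¹ : G) • a = g⁻¹ • a := by
      rw [mul_inv_rev, mul_smul, inv_smul_eq_iff.2 (MulAction.mem_stabilizer_iff.1 hh).symm]
    change _ ∈ descendants (((h * g)⁻¹ : G) • a) at this
    rw [e] at this
    exact this
  -- Both g⁻¹b and (hg)⁻¹b are descendants of g⁻¹a ≠ a, so some `t` fixes `b` and moves the first to
  -- the second. Then hgtg⁻¹ fixes `b`, and hg = (hgtg⁻¹) g t⁻¹.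
  obtain ⟨t, ht, -, -, ht1, ht2⟩ := hG.2 a (g⁻¹ • a) (smul_level (g⁻¹ : G).1 a).symm hne
    b hb _ h1 b hb _ h2
  lift t to G using ht
  change t • b = b at ht1
  change t • g⁻¹ • b = (h * g)⁻¹ • b at ht2
  refine ⟨h * g * t * g⁻¹, ?_, t⁻¹, ?_, by group⟩
  · rw [MulAction.mem_stabilizer_iff, mul_smul, mul_smul, ht2, smul_inv_smul]
  · exact inv_mem (s := St G b) ht1

instance [∀ i, Finite (X i)] (a : Vertex X) : Finite (G ⧸ St G a) := by
  have : Finite (MulAction.orbit G a) := by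
    have hl : ∀ b : MulAction.orbit G a, b.1.level = a.level := by
      rintro ⟨_, g, rfl⟩
      exact smul_level g.1 a
    exact Finite.of_injective (β := Level X a.level) (fun b => ⟨b.1, hl b⟩)
      fun _ _ h => Subtype.ext (congrArg (fun b : Level X _ => b.1) h)
  exact Finite.of_equiv _ (MulAction.orbitEquivQuotientStabilizer G a)

/-! ### Locally constant functions on the boundary -/

theorem exists_boundary_pre_eq [∀ i, Nontrivial (X i)] (b : Vertex X) :
    ∃ ξ : Boundary X, ξ.pre b.level = b := by
  classical
  refine ⟨fun i => if h : i < b.level then b.word ⟨i, h⟩ else Classical.arbitrary _,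
    vertex_ext rfl fun i ha hb => ?_⟩
  exact dif_pos hb

theorem Boundary.pre_succ_mem (ξ : Boundary X) (n : ℕ) : ξ.pre (n + 1) ∈ descendants (ξ.pre n) :=
  mem_descendants.2 (ξ.pre_isChild n)

theorem isOpen_cylinder (ξ : Boundary X) (n : ℕ) :
    IsOpen {η : Boundary X | η.pre n = ξ.pre n} := by
  let _ : ∀ i, TopologicalSpace (X i) := fun _ => ⊥
  have _ : ∀ i, DiscreteTopology (X i) := fun _ => ⟨rfl⟩
  have ho : IsOpen (Set.pi (Set.Iio n) fun j => ({ξ j} : Set (X j))) :=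
    isOpen_set_pi (Set.finite_Iio _) fun _ _ => isOpen_discrete _
  convert! ho using 1
  ext η
  refine ⟨fun h j hj => ?_, fun h => vertex_ext rfl fun j hj _ => h j hj⟩
  exact word_congr h hj hj

/-- A function of the vertices of level `n`, as a locally constant function on the boundary. -/
def levelFun (F : Type*) [Field F] (X : ℕ → Type v) (n : ℕ) :
    (Vertex X → F) →ₗ[F] LocallyConstant (Boundary X) F where
  toFun f := ⟨fun ξ => f (ξ.pre n), (IsLocallyConstant.iff_exists_open _).2 fun ξ =>
    ⟨_, isOpen_cylinder ξ n, rfl, fun _ hη => congrArg f hη⟩⟩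
  map_add' _ _ := rfl
  map_smul' _ _ := rfl

theorem levelFun_apply {F : Type*} [Field F] (n : ℕ) (f : Vertex X → F) (ξ : Boundary X) :
    levelFun F X n f ξ = f (ξ.pre n) := rfl

instance [∀ i, Finite (X i)] : CompactSpace (Boundary X) := by
  let _ : ∀ i, TopologicalSpace (X i) := fun _ => ⊥
  exact inferInstanceAs (CompactSpace (∀ i, X i))

theorem exists_cylinder_subset {s : Set (Boundary X)} (hs : IsOpen s) {ξ : Boundary X} (hξ : ξ ∈ s) :
    ∃ n, ∀ η : Boundary X, η.pre n = ξ.pre n → η ∈ s := by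
  let _ : ∀ i, TopologicalSpace (X i) := fun _ => ⊥
  obtain ⟨I, u, hu, hsub⟩ := isOpen_pi_iff.1 hs ξ hξ
  refine ⟨I.sup id + 1, fun η hη => hsub fun i hi => ?_⟩
  have hlt : i < I.sup id + 1 := Nat.lt_succ_of_le (Finset.le_sup (f := id) hi)
  have : η i = ξ i := word_congr hη hlt hlt
  rw [this]
  exact (hu i hi).2

/-- Every locally constant function on the boundary comes from a level. -/
theorem exists_eq_levelFun {F : Type*} [Field F] [∀ i, Finite (X i)] [∀ i, Nontrivial (X i)]
    (f : LocallyConstant (Boundary X) F) : ∃ n φ, f = levelFun F X n φ := by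
  classical
  have hloc : ∀ ξ, ∃ n, ∀ η : Boundary X, η.pre n = ξ.pre n → f η = f ξ := fun ξ =>
    exists_cylinder_subset (f.isLocallyConstant.isOpen_fiber (f ξ)) (by rfl)
  choose n hn using hloc
  -- By compactness finitely many cylinders of constancy cover the boundary, and their greatest
  -- depth serves as the level.
  obtain ⟨t, ht⟩ := isCompact_univ.elim_finite_subcover
    (fun ξ => {η : Boundary X | η.pre (n ξ) = ξ.pre (n ξ)}) (fun ξ => isOpen_cylinder ξ (n ξ))
    fun ξ _ => Set.mem_iUnion.2 ⟨ξ, rfl⟩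
  have key : ∀ ξ η : Boundary X, ξ.pre (t.sup n) = η.pre (t.sup n) → f ξ = f η := fun ξ η h => by
    obtain ⟨ζ, hζ, hξ⟩ := Set.mem_iUnion₂.1 (ht (Set.mem_univ ξ))
    have hle : n ζ ≤ t.sup n := Finset.le_sup hζ
    have hη : η.pre (n ζ) = ζ.pre (n ζ) := by
      rw [← show ξ.pre (n ζ) = ζ.pre (n ζ) from hξ]
      refine vertex_ext rfl fun i hi _ => ?_
      exact word_congr h.symm (lt_of_lt_of_le hi hle) (lt_of_lt_of_le hi hle)
    rw [hn ζ ξ hξ, hn ζ η hη]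
  choose r hr using exists_boundary_pre_eq (X := X)
  refine ⟨t.sup n, fun b => f (r b), LocallyConstant.ext fun ξ => ?_⟩
  rw [levelFun_apply]
  exact key _ _ (hr (ξ.pre (t.sup n))).symm

theorem boundaryRep_levelFun {F : Type*} [Field F] (n : ℕ) (f : Vertex X → F) (g : G) :
    boundaryRep F G g (levelFun F X n f) = levelFun F X n fun b => f (g⁻¹ • b) := by
  refine LocallyConstant.ext fun ξ => ?_
  show f (Boundary.pre ((g⁻¹ : G).1 • ξ) n) = f ((g⁻¹ : G).1 • ξ.pre n)
  rw [Boundary.smul_pre]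

end Tree

/-! ### Induced representations as functions on the boundary -/

section Boundary

variable {F : Type u} [Field F] {X : ℕ → Type v} {G : Subgroup (rootedAut X)} {a : Vertex X}
  {V : Type*} [AddCommGroup V] [Module F V] {π : Representation F (St G a) V}

theorem coeff_descRep (h : St G a) (z : MonoidAlgebra F (descendants a)) (d : descendants a) :
    (descRep F G a h z).coeff d = z.coeff (h⁻¹ • d) :=
  Representation.coeff_ofMulAction h z d

/-- A vector all of whose coefficients are equal is invariant, and conversely. -/
theorem descRep_invariant_iff (hG : IsSphericallyTransitive G)
    {z : MonoidAlgebra F (descendants a)} :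
    (∀ h, descRep F G a h z = z) ↔ ∀ d d', z.coeff d = z.coeff d' := by
  refine ⟨fun hz d d' => ?_, fun hz h => ?_⟩
  · obtain ⟨h, rfl⟩ := exists_stabilizer_smul_eq hG d' d
    conv_lhs => rw [← hz h, coeff_descRep, inv_smul_smul]
  · refine MonoidAlgebra.ext (Finsupp.ext fun d => ?_)
    rw [coeff_descRep]
    exact hz _ _

/-- The evaluation at a descendant. -/
noncomputable def evalDesc (d : descendants a) : MonoidAlgebra F (descendants a) →ₗ[F] F :=
  Finsupp.lapply d ∘ₗ (MonoidAlgebra.coeffLinearEquiv F).toLinearMap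

theorem evalDesc_apply (d : descendants a) (z : MonoidAlgebra F (descendants a)) :
    evalDesc d z = z.coeff d := rfl

variable (ι : Representation.IntertwiningMap π (descRep F G a))

/-- Well-definedness of `vertexFun`: two ways of writing a vertex as a translate of a descendant of
`a` differ by an element of St(a), which the equivariance of `f` and `ι` absorbs. -/
theorem coeff_eq_of_smul_eq (f : Representation.coindV (St G a).subtype π) {g g' : G}
    {d d' : descendants a} (h : g • d.1 = g' • d'.1) :
    (ι (f.1 g⁻¹)).coeff d = (ι (f.1 g'⁻¹)).coeff d' := by
  have h1 : (g'⁻¹ * g) • d.1 = d'.1 := by rw [mul_smul, h, inv_smul_smul]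
  have hm : g'⁻¹ * g ∈ St G a := smul_eq_of_mem_descendants (g'⁻¹ * g : G).1 d.2 d'.2 h1
  have h2 : (⟨g'⁻¹ * g, hm⟩ : St G a) • d = d' := Subtype.ext h1
  have h3 : g'⁻¹ = (g'⁻¹ * g) * g⁻¹ := by group
  rw [h3, coind_apply_mul f hm, ι.isIntertwining, coeff_descRep, ← h2, inv_smul_smul]

open Classical in
/-- The element `f` of the induced representation as a function of the vertices of the level
following `a`: its restriction to the descendants of `g a` is the translate of `f g⁻¹`. -/
noncomputable def vertexFun : Representation.coindV (St G a).subtype π →ₗ[F] (Vertex X → F) where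
  toFun f y := if h : ∃ (g : G) (d : descendants a), g • d.1 = y then
    (ι (f.1 h.choose⁻¹)).coeff h.choose_spec.choose else 0
  map_add' f f' := by
    funext y
    by_cases h : ∃ (g : G) (d : descendants a), g • d.1 = y
    · simp only [dif_pos h, Pi.add_apply]
      rw [Submodule.coe_add, Pi.add_apply, map_add]
      rfl
    · simp only [dif_neg h, Pi.add_apply, add_zero]
  map_smul' c f := by
    funext y
    by_cases h : ∃ (g : G) (d : descendants a), g • d.1 = y
    · simp only [dif_pos h, Pi.smul_apply]
      rw [Submodule.coe_smul, Pi.smul_apply, map_smul]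
      rfl
    · simp only [dif_neg h, Pi.smul_apply, smul_zero]

theorem vertexFun_apply (f : Representation.coindV (St G a).subtype π) {g : G}
    {d : descendants a} {y : Vertex X} (h : g • d.1 = y) :
    vertexFun ι f y = (ι (f.1 g⁻¹)).coeff d := by
  have hex : ∃ (g : G) (d : descendants a), g • d.1 = y := ⟨g, d, h⟩
  refine (dif_pos hex).trans (coeff_eq_of_smul_eq ι f ?_)
  rw [hex.choose_spec.choose_spec, h]

theorem exists_smul_descendant (hG : IsSphericallyTransitive G) [∀ i, Nontrivial (X i)]
    {y : Vertex X} (hy : y.level = a.level + 1) : ∃ (g : G) (d : descendants a), g • d.1 = y := by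
  obtain ⟨b, hb⟩ := exists_mem_descendants a
  obtain ⟨g, hg⟩ := exists_smul_eq hG (a := b) (b := y) (hb.2.trans hy.symm)
  exact ⟨g, ⟨b, hb⟩, hg⟩

/-- The map from the induced representation to the functions on the boundary. -/
noncomputable def boundaryMap (hG : IsSphericallyTransitive G) [∀ i, Nontrivial (X i)] :
    Representation.IntertwiningMap (ind G a π) (boundaryRep F G) :=
  ⟨levelFun F X (a.level + 1) ∘ₗ vertexFun ι, fun g => LinearMap.ext fun f => by
    show levelFun F X (a.level + 1) (vertexFun ι (ind G a π g f)) =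
      boundaryRep F G g (levelFun F X (a.level + 1) (vertexFun ι f))
    rw [boundaryRep_levelFun]
    refine LocallyConstant.ext fun ξ => ?_
    rw [levelFun_apply, levelFun_apply]
    obtain ⟨k, d, h⟩ := exists_smul_descendant (a := a) hG (y := ξ.pre (a.level + 1)) rfl
    rw [vertexFun_apply ι _ h, vertexFun_apply ι f (g := g⁻¹ * k) (d := d) (by rw [mul_smul, h]),
      coind_val, show (g⁻¹ * k)⁻¹ = k⁻¹ * g by group]⟩

theorem boundaryMap_eq (hG : IsSphericallyTransitive G) [∀ i, Nontrivial (X i)]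
    (f : Representation.coindV (St G a).subtype π) :
    boundaryMap ι hG f = levelFun F X (a.level + 1) (vertexFun ι f) := rfl

/-- A ray through a given vertex. -/
noncomputable def rayThrough [∀ i, Nontrivial (X i)] (b : Vertex X) : Boundary X :=
  (exists_boundary_pre_eq b).choose

theorem rayThrough_pre [∀ i, Nontrivial (X i)] {b : Vertex X} {n : ℕ} (h : b.level = n) :
    (rayThrough b).pre n = b := by
  subst h
  exact (exists_boundary_pre_eq b).choose_spec

theorem level_smul_descendant (g : G) (d : descendants a) : (g • d.1).level = a.level + 1 :=
  (smul_level g.1 d.1).trans d.2.2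

/-- The extension by zero of a function on the descendants of `a` to all vertices. -/
noncomputable def extendDesc (F : Type u) [Field F] (a : Vertex X) :
    MonoidAlgebra F (descendants a) →ₗ[F] (Vertex X → F) := by
  classical
  exact LinearMap.pi fun y => if h : y ∈ descendants a then evalDesc ⟨y, h⟩ else 0

theorem extendDesc_apply (z : MonoidAlgebra F (descendants a)) {y : Vertex X}
    (h : y ∈ descendants a) : extendDesc F a z y = z.coeff ⟨y, h⟩ := by
  simp only [extendDesc, LinearMap.pi_apply, dif_pos h, evalDesc_apply]

theorem extendDesc_apply_of_notMem (z : MonoidAlgebra F (descendants a)) {y : Vertex X}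
    (h : y ∉ descendants a) : extendDesc F a z y = 0 := by
  simp only [extendDesc, LinearMap.pi_apply, dif_neg h, LinearMap.zero_apply]

theorem boundaryMap_coindSingle (hG : IsSphericallyTransitive G) [∀ i, Nontrivial (X i)] (x : V) :
    boundaryMap ι hG (coindSingle _ π x) = levelFun F X (a.level + 1) (extendDesc F a (ι x)) := by
  rw [boundaryMap_eq]
  refine LocallyConstant.ext fun ξ => ?_
  rw [levelFun_apply, levelFun_apply]
  obtain ⟨g, d, hg⟩ := exists_smul_descendant (a := a) hG (y := ξ.pre (a.level + 1)) rfl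
  rw [vertexFun_apply ι _ hg]
  by_cases hm : g ∈ St G a
  · have hd : g • d.1 ∈ descendants a := ((⟨g, hm⟩ : St G a) • d).2
    rw [coindSingle_apply_mem _ (inv_mem hm), ι.isIntertwining, coeff_descRep, ← hg,
      extendDesc_apply _ hd]
    congr 1
  · rw [coindSingle_apply_notMem _ fun h => hm (inv_mem_iff.1 h), map_zero,
      extendDesc_apply_of_notMem]
    · rfl
    · rw [← hg]
      intro hd
      exact hm (smul_eq_of_mem_descendants g.1 d.2 hd rfl)

/-- An invariant vector is constant on the descendants of `a`, so its extension only detects whether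
a ray passes through `a`. Hence the trivial part of F[D(a)] contributes nothing new beyond the level
of `a`. -/
theorem exists_levelFun_extendDesc_eq (hG : IsSphericallyTransitive G) [∀ i, Nontrivial (X i)]
    {z : MonoidAlgebra F (descendants a)} (hz : ∀ h, descRep F G a h z = z) :
    ∃ f, levelFun F X (a.level + 1) (extendDesc F a z) = levelFun F X a.level f := by
  classical
  obtain ⟨b, hb⟩ := exists_mem_descendants a
  refine ⟨fun y => if y = a then z.coeff ⟨b, hb⟩ else 0, LocallyConstant.ext fun ξ => ?_⟩
  rw [levelFun_apply, levelFun_apply]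
  by_cases hξ : ξ.pre a.level = a
  · have hd : ξ.pre (a.level + 1) ∈ descendants a := by
      have := ξ.pre_succ_mem a.level
      rwa [hξ] at this
    rw [if_pos hξ, extendDesc_apply _ hd]
    exact (descRep_invariant_iff hG).1 hz _ _
  · rw [if_neg hξ, extendDesc_apply_of_notMem]
    intro hd
    exact hξ (parent_unique (ξ.pre_isChild a.level) (mem_descendants.1 hd))

/-- A `G`-invariant space of functions on the boundary that contains the functions supported on
the descendants of a vertex contains all functions of the next level. -/
theorem levelFun_succ_mem [∀ i, Finite (X i)] [∀ i, Nontrivial (X i)]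
    (hG : IsSphericallyTransitive G)
    (U : Submodule F (LocallyConstant (Boundary X) F))
    (hU : ∀ g : G, ∀ f ∈ U, boundaryRep F G g f ∈ U)
    (h : ∀ z, levelFun F X (a.level + 1) (extendDesc F a z) ∈ U) (f : Vertex X → F) :
    levelFun F X (a.level + 1) f ∈ U := by
  classical
  -- By spherical transitivity the indicator of each vertex of the level is a translate of that of a
  -- descendant of `a`.
  have hdelta : ∀ y : Level X (a.level + 1),
      levelFun F X (a.level + 1) (fun y' => if y' = y.1 then 1 else 0) ∈ U := by
    intro y
    obtain ⟨g, d, hg⟩ := exists_smul_descendant (a := a) hG y.2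
    have := hU g _ (h (MonoidAlgebra.single d 1))
    rw [boundaryRep_levelFun] at this
    convert! this using 2
    funext y'
    by_cases hy : g⁻¹ • y' = d.1
    · rw [if_pos (by rw [← hg, ← hy, smul_inv_smul]), extendDesc_apply _ (hy ▸ d.2),
        show (⟨g⁻¹ • y', hy ▸ d.2⟩ : descendants a) = d from Subtype.ext hy]
      simp
    · rw [if_neg fun h => hy (by rw [h, ← hg, inv_smul_smul])]
      by_cases hd : g⁻¹ • y' ∈ descendants a
      · rw [extendDesc_apply _ hd]
        simp [Subtype.ext_iff, Ne.symm hy]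
      · rw [extendDesc_apply_of_notMem _ hd]
  have : Fintype (Level X (a.level + 1)) := Fintype.ofFinite _
  have hsum : levelFun F X (a.level + 1) f = ∑ y : Level X (a.level + 1),
      f y.1 • levelFun F X (a.level + 1) (fun y' => if y' = y.1 then 1 else 0) := by
    simp_rw [← map_smul, ← map_sum]
    refine LocallyConstant.ext fun ξ => ?_
    rw [levelFun_apply, levelFun_apply, Finset.sum_apply,
      Finset.sum_eq_single (⟨ξ.pre (a.level + 1), rfl⟩ : Level X (a.level + 1))]
    · simp
    · intro y _ hy
      have : ξ.pre (a.level + 1) ≠ y.1 := fun h => hy (Subtype.ext h.symm)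
      simp [this]
    · simp
  rw [hsum]
  exact Submodule.sum_mem _ fun y _ => Submodule.smul_mem _ _ (hdelta y)

variable [∀ i, Finite (X i)] [∀ i, Nontrivial (X i)]

variable (F a) in
/-- The restriction of a function on the boundary to rays through the descendants of `g a`. -/
noncomputable def sample (g : G) :
    LocallyConstant (Boundary X) F →ₗ[F] MonoidAlgebra F (descendants a) :=
  (MonoidAlgebra.coeffLinearEquiv F).symm.toLinearMap ∘ₗ
    (Finsupp.linearEquivFunOnFinite F F (descendants a)).symm.toLinearMap ∘ₗ
    { toFun := fun f d => f (rayThrough (g • d.1))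
      map_add' := fun _ _ => rfl
      map_smul' := fun _ _ => rfl }

theorem coeff_sample (g : G) (f : LocallyConstant (Boundary X) F) (d : descendants a) :
    (sample F a g f).coeff d = f (rayThrough (g • d.1)) := rfl

theorem sample_boundaryMap (hG : IsSphericallyTransitive G) (g : G)
    (f : Representation.coindV (St G a).subtype π) :
    sample F a g (boundaryMap ι hG f) = ι (f.1 g⁻¹) := by
  refine MonoidAlgebra.ext (Finsupp.ext fun d => ?_)
  rw [coeff_sample, boundaryMap_eq, levelFun_apply, rayThrough_pre (level_smul_descendant g d)]
  exact vertexFun_apply ι f rfl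

/-- All descendants of ga share their prefix of length `m`, so the sampled function is constant.
This is what makes the decomposition triangular. -/
theorem sample_levelFun_invariant (hG : IsSphericallyTransitive G) (g : G) {m : ℕ}
    (hm : m ≤ a.level) (f : Vertex X → F) (h : St G a) :
    descRep F G a h (sample F a g (levelFun F X m f)) = sample F a g (levelFun F X m f) := by
  refine (descRep_invariant_iff hG).2 (fun d d' => ?_) h
  have key : ∀ d : descendants a, (rayThrough (g • d.1)).pre m =
      pre (g • a) m (hm.trans_eq (smul_level g.1 a).symm) := fun d => by
    have h1 : g • d.1 ∈ descendants (g • a) := smul_mem_descendants g.1 d.2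
    rw [← pre_eq_of_mem h1 (hm.trans_eq (smul_level g.1 a).symm)
      (by rw [level_smul_descendant]; omega)]
    have h2 := rayThrough_pre (level_smul_descendant g d)
    refine vertex_ext rfl fun i hi _ => ?_
    have hi' : i < a.level + 1 := Nat.lt_succ_of_lt (lt_of_lt_of_le hi hm)
    exact word_congr h2 hi' (by rwa [level_smul_descendant])
  rw [coeff_sample, coeff_sample, levelFun_apply, levelFun_apply, key, key]

end Boundary

/-! ### Decomposition of the boundary representation -/

section Decomposition

variable {F : Type u} [Field F] {X : ℕ → Type v} {G : Subgroup (rootedAut X)}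

theorem descRep_eq_one_of_levelPerm {a : Vertex X} {h : St G a}
    (hh : levelPerm X (a.level + 1) h.1.1 = 1) : descRep F G a h = 1 := by
  refine LinearMap.ext fun z => MonoidAlgebra.ext (Finsupp.ext fun d => ?_)
  rw [coeff_descRep]
  congr 1
  rw [inv_smul_eq_iff]
  exact Subtype.ext (levelPerm_eq_one_iff.1 hh d.1 d.2.2).symm

variable [∀ i, Finite (X i)] [∀ i, Nontrivial (X i)]

/-- A `G`-invariant space of functions on the boundary that contains the constants and the images
of the induced representations contains all functions of finite level. -/
theorem levelFun_mem_of_boundaryMap_mem {I : ℕ → Type*} (hG : IsSphericallyTransitive G)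
    {a : ℕ → Vertex X} (ha : ∀ n, (a n).level = n) {V : ∀ n, I n → Type*}
    [∀ n i, AddCommGroup (V n i)] [∀ n i, Module F (V n i)]
    {π : ∀ n i, Representation F (St G (a n)) (V n i)}
    (ι : ∀ n i, Representation.IntertwiningMap (π n i) (descRep F G (a n)))
    (hsup : ∀ n (U : Submodule F (MonoidAlgebra F (descendants (a n)))),
      (∀ i x, ι n i x ∈ U) → (∀ z, (∀ h, descRep F G (a n) h z = z) → z ∈ U) → ∀ z, z ∈ U)
    (U : Submodule F (LocallyConstant (Boundary X) F))
    (hU : ∀ g : G, ∀ f ∈ U, boundaryRep F G g f ∈ U)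
    (hconst : ∀ c : F, levelFun F X 0 (fun _ => c) ∈ U)
    (hι : ∀ n i x, boundaryMap (ι n i) hG x ∈ U) (n : ℕ) (f : Vertex X → F) :
    levelFun F X n f ∈ U := by
  induction n generalizing f with
  | zero =>
    convert! hconst (f (root X)) using 1
    refine LocallyConstant.ext fun ξ => ?_
    rw [levelFun_apply, levelFun_apply, eq_root (a := ξ.pre 0) rfl]
  | succ n ih =>
    have key := levelFun_succ_mem (a := a n) hG U hU (hsup n
      (U.comap (levelFun F X ((a n).level + 1) ∘ₗ extendDesc F (a n))) (fun i x => ?_)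
      fun z hz => ?_) f
    · rwa [ha] at key
    · rw [Submodule.mem_comap, LinearMap.comp_apply, ← boundaryMap_coindSingle _ hG]
      exact hι n i _
    · obtain ⟨f', hf'⟩ := exists_levelFun_extendDesc_eq hG hz
      rw [Submodule.mem_comap, LinearMap.comp_apply, hf', ha]
      exact ih f'

/-- The boundary representation is the direct sum of the constants and the representations
induced from nontrivial irreducible constituents at one vertex of each level. -/
theorem nonempty_boundaryRep_equiv {I : ℕ → Type*} (hG : IsSphericallyTransitive G)
    {a : ℕ → Vertex X} (ha : ∀ n, (a n).level = n) {V : ∀ n, I n → Type*}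
    [∀ n i, AddCommGroup (V n i)] [∀ n i, Module F (V n i)]
    {π : ∀ n i, Representation F (St G (a n)) (V n i)}
    (hπ : ∀ n i x, (∀ h, π n i h x = x) → x = 0)
    (ι : ∀ n i, Representation.IntertwiningMap (π n i) (descRep F G (a n)))
    (q : ∀ n i, Representation.IntertwiningMap (descRep F G (a n)) (π n i))
    (hq : ∀ n i x, q n i (ι n i x) = x)
    (hq' : ∀ n i j, i ≠ j → ∀ x, q n i (ι n j x) = 0)
    (hsup : ∀ n (U : Submodule F (MonoidAlgebra F (descendants (a n)))),
      (∀ i x, ι n i x ∈ U) → (∀ z, (∀ h, descRep F G (a n) h z = z) → z ∈ U) → ∀ z, z ∈ U) :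
    Nonempty (Representation.Equiv (boundaryRep F G)
      ((Representation.trivial F G F).prod
        (Representation.directSum fun s : (Σ n, I n) => ind G (a s.1) (π s.1 s.2)))) := by
  classical
  let Φ : ∀ s : (Σ n, I n), Representation.IntertwiningMap (ind G (a s.1) (π s.1 s.2))
    (boundaryRep F G) := fun s => boundaryMap (ι s.1 s.2) hG
  let D := directSumLift Φ
  let C : F →ₗ[F] LocallyConstant (Boundary X) F := levelFun F X 0 ∘ₗ LinearMap.pi fun _ => LinearMap.id
  let T : Representation.IntertwiningMap ((Representation.trivial F G F).prod
      (Representation.directSum fun s : (Σ n, I n) => ind G (a s.1) (π s.1 s.2)))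
      (boundaryRep F G) :=
    ⟨C.coprod D.toLinearMap, fun g => LinearMap.ext fun x => by
      show C x.1 + D (Representation.directSum _ g x.2) = boundaryRep F G g (C x.1 + D x.2)
      rw [D.isIntertwining, map_add]
      rfl⟩
  have hqlevel : ∀ n i g m, m ≤ n → ∀ f : Vertex X → F,
      q n i (sample F (a n) g (levelFun F X m f)) = 0 := fun n i g m hm f => by
    refine hπ n i _ fun h => ?_
    rw [← (q n i).isIntertwining, sample_levelFun_invariant hG g (by rwa [ha])]
  have hΦ : ∀ (t : Σ n, I n) (g : G) (s : Σ n, I n) x, s ≠ t → s.1 ≤ t.1 →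
      q t.1 t.2 (sample F (a t.1) g (Φ s x)) = 0 := by
    rintro ⟨n, i⟩ g ⟨m, j⟩ x hst hle
    rcases Nat.eq_or_lt_of_le hle with h | h
    · dsimp only at h
      subst h
      show q m i (sample F (a m) g (boundaryMap (ι m j) hG x)) = 0
      rw [sample_boundaryMap, hq' m i j fun h => hst (by rw [h])]
    -- The image of a summand at level m has level m + 1, which is still at most n since m < n.
    · exact hqlevel n i g _ (by rw [ha]; exact h) _
  have hD : ∀ (t : Σ n, I n) (g : G) x, (∀ s, t.1 < s.1 → x s = 0) →
      q t.1 t.2 (sample F (a t.1) g (D x)) = (x t).1 g⁻¹ := by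
    intro t g x hx
    have hx' : D x = ∑ s ∈ DFinsupp.support x, Φ s (x s) := by
      conv_lhs => rw [← DirectSum.sum_support_of x]
      rw [map_sum]
      exact Finset.sum_congr rfl fun s _ => directSumLift_lof Φ s (x s)
    rw [hx', map_sum, map_sum, Finset.sum_eq_single t]
    · show q t.1 t.2 (sample F (a t.1) g (boundaryMap (ι t.1 t.2) hG (x t))) = _
      rw [sample_boundaryMap, hq]
    · intro s _ hst
      rcases le_or_gt s.1 t.1 with hle | hlt
      · exact hΦ t g s _ hst hle
      · rw [hx s hlt, map_zero, map_zero, map_zero]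
    · intro ht
      rw [DFinsupp.notMem_support_iff.1 ht, map_zero, map_zero, map_zero]
  have hinj : Function.Injective T := by
    suffices H : ∀ c x, C c + D x = 0 → c = 0 ∧ x = 0 by
      rintro ⟨c, x⟩ ⟨c', x'⟩ h
      change C c + D x = C c' + D x' at h
      have hsub : D (x - x') = D x - D x' := map_sub D.toLinearMap x x'
      obtain ⟨h1, h2⟩ := H (c - c') (x - x') (by
        rw [map_sub, hsub, sub_add_sub_comm, h, sub_self])
      rw [sub_eq_zero.1 h1, sub_eq_zero.1 h2]
    intro c x h
    have hx0 : x = 0 := by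
      by_contra hne
      have hsupp : (DFinsupp.support x).Nonempty := by
        rw [Finset.nonempty_iff_ne_empty, Ne, DFinsupp.support_eq_empty]
        exact hne
      -- At an index of greatest level in the support, sampling followed by projection kills all
      -- other terms and the constant, and so recovers the component of `x`.
      obtain ⟨t, ht, hmax⟩ := Finset.exists_max_image (DFinsupp.support x) (fun s => s.1) hsupp
      refine DFinsupp.mem_support_iff.1 ht (Subtype.ext (funext fun g => ?_))
      have h1 := hD t g⁻¹ x fun s hs => by
        by_contra hs'
        exact absurd (hmax s (DFinsupp.mem_support_iff.2 hs')) (not_le.2 hs)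
      rw [inv_inv] at h1
      rw [← h1, ← zero_add (q t.1 t.2 _), ← hqlevel t.1 t.2 g⁻¹ 0 (Nat.zero_le _) (fun _ => c),
        ← map_add, ← map_add, show levelFun F X 0 (fun _ => c) + D x = 0 from h, map_zero, map_zero]
      rfl
    rw [hx0, map_zero, add_zero] at h
    have hc : c = 0 := LocallyConstant.congr_fun h (rayThrough (root X))
    exact ⟨hc, hx0⟩
  have hsurj : Function.Surjective T := fun f => by
    obtain ⟨n, φ, rfl⟩ := exists_eq_levelFun f
    refine levelFun_mem_of_boundaryMap_mem hG ha ι hsup (LinearMap.range T.toLinearMap) ?_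
      (fun c => ⟨(c, 0), ?_⟩) (fun n i x => ⟨(0, DirectSum.lof F _ _ ⟨n, i⟩ x), ?_⟩) n φ
    · rintro g _ ⟨x, rfl⟩
      exact ⟨_, T.isIntertwining _ _ g x⟩
    · show C c + D 0 = _
      rw [map_zero, add_zero]
      rfl
    · show C 0 + D (DirectSum.lof F _ _ _ _) = _
      rw [map_zero, zero_add]
      exact directSumLift_lof Φ ⟨n, i⟩ x
  exact ⟨(Representation.IntertwiningMap.ofBijective T ⟨hinj, hsurj⟩).symm⟩

end Decomposition

/-! ### Irreducibility and distinctness for locally 2-transitive groups -/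

section Main

variable {F : Type u} [Field F] {X : ℕ → Type v} {G : Subgroup (rootedAut X)} {a : Vertex X}
  {V W : Type*} [AddCommGroup V] [Module F V] [AddCommGroup W] [Module F W]
  {π : Representation F (St G a) V}

/-- The evaluation of an embedded irreducible representation at a descendant. -/
theorem exists_functional (hG : IsSphericallyTransitive G) (hπ : π.IsIrreducible)
    (hm : mult π (descRep F G a) ≠ 0) {b : Vertex X} (hb : b ∈ descendants a) :
    ∃ l : V →ₗ[F] F, l ≠ 0 ∧
      ∀ k (hk : k ∈ St G b) x, l (π ⟨k, stabilizer_le hb hk⟩ x) = l x := by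
  obtain ⟨ι, hι⟩ := exists_injective_of_mult_ne_zero hm
  refine ⟨evalDesc ⟨b, hb⟩ ∘ₗ ι.toLinearMap, fun h0 => ?_, fun k hk x => ?_⟩
  · have := nontrivial_of_irreducible hπ
    obtain ⟨x, hx⟩ := exists_ne (0 : V)
    refine hx (hι ?_)
    rw [map_zero]
    refine MonoidAlgebra.ext (Finsupp.ext fun d => ?_)
    -- If the coefficient at `b` vanishes on the image of `ι`, then transitivity on the descendants
    -- makes every coefficient vanish.
    obtain ⟨h, hh⟩ := exists_stabilizer_smul_eq hG ⟨b, hb⟩ d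
    have h1 : (ι (π h⁻¹ x)).coeff ⟨b, hb⟩ = 0 := LinearMap.congr_fun h0 (π h⁻¹ x)
    rw [ι.isIntertwining, coeff_descRep, inv_inv, hh] at h1
    exact h1
  · show (ι (π _ x)).coeff ⟨b, hb⟩ = (ι x).coeff ⟨b, hb⟩
    rw [ι.isIntertwining, coeff_descRep]
    congr 1
    rw [inv_smul_eq_iff]
    exact Subtype.ext hk.symm

theorem eq_one_of_levelPerm (hm : mult π (descRep F G a) ≠ 0) {h : St G a}
    (hh : levelPerm X (a.level + 1) h.1.1 = 1) : π h = 1 := by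
  obtain ⟨ι, hι⟩ := exists_injective_of_mult_ne_zero hm
  refine LinearMap.ext fun x => hι ?_
  rw [ι.isIntertwining, descRep_eq_one_of_levelPerm hh]
  rfl

theorem ker_levelPerm_le {b : Vertex X} {n : ℕ} (hb : b.level = n) :
    ((levelPerm X n).comp G.subtype).ker ≤ St G b :=
  fun _ hg => levelPerm_eq_one_iff.1 hg b hb

theorem stabilizer_pre_le (ξ : Boundary X) {m n : ℕ} (h : m ≤ n) :
    St G (ξ.pre n) ≤ St G (ξ.pre m) :=
  antitone_nat_of_succ_le (f := fun k => St G (ξ.pre k)) (fun k => stabilizer_le (ξ.pre_succ_mem k)) h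

variable [∀ i, Nontrivial (X i)]

theorem ind_eq_zero_of_invariant (hG : IsLocallyTwoTransitive G)
    (h : IsNontrivialConstituent G a π) {f : Representation.coindV (St G a).subtype π}
    (hf : ∀ g ∈ St G a, ind G a π g f = f) : f = 0 := by
  obtain ⟨b, hb⟩ := exists_mem_descendants a
  obtain ⟨l, hl, hlK⟩ := exists_functional hG.1 h.irreducible h.occurs hb
  exact coind_eq_zero_of_invariant (stabilizer_le hb) (exists_double_coset hG hb) h.irreducible
    h.nontrivial hl hlK hf

theorem isEmpty_trivial_equiv_ind (hG : IsLocallyTwoTransitive G)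
    (h : IsNontrivialConstituent G a π) :
    IsEmpty (Representation.Equiv (Representation.trivial F G F) (ind G a π)) := by
  refine ⟨fun T => one_ne_zero (α := F) (T.injective ?_)⟩
  rw [map_zero]
  exact ind_eq_zero_of_invariant hG h fun g _ =>
    (T.toIntertwiningMap.isIntertwining _ _ g 1).symm

variable [∀ i, Finite (X i)]

theorem ind_isIrreducible (hG : IsLocallyTwoTransitive G)
    (hF : CharNotDvdSteinitzOrder F G.topologicalClosure) (h : IsNontrivialConstituent G a π) :
    (ind G a π).IsIrreducible := by
  obtain ⟨b, hb⟩ := exists_mem_descendants a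
  obtain ⟨l, hl, hlK⟩ := exists_functional hG.1 h.irreducible h.occurs hb
  exact coind_isIrreducible (stabilizer_le hb) (exists_double_coset hG hb) h.irreducible
    h.nontrivial hl hlK _ (ker_levelPerm_le hb.2) (card_levelPerm_ne_zero hF _)
    fun _ hh => eq_one_of_levelPerm h.occurs hh

/-- The induced representation has a nonzero vector fixed by the stabiliser of any given vertex
of the next level. -/
theorem exists_invariant_ind (hG : IsLocallyTwoTransitive G)
    (hF : CharNotDvdSteinitzOrder F G.topologicalClosure) (h : IsNontrivialConstituent G a π)
    {c : Vertex X} (hc : c.level = a.level + 1) :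
    ∃ f, f ≠ 0 ∧ ∀ g ∈ St G c, ind G a π g f = f := by
  obtain ⟨b, hb⟩ := exists_mem_descendants a
  obtain ⟨l, hl, hlK⟩ := exists_functional hG.1 h.irreducible h.occurs hb
  have := nontrivial_of_irreducible (ind_isIrreducible hG hF h)
  obtain ⟨f₀, hf₀⟩ := exists_ne (0 : Representation.coindV (St G a).subtype π)
  obtain ⟨f, -, hf, hinv⟩ := exists_invariant_mem (stabilizer_le hb) h.irreducible hl hlK
    ((levelPerm X (a.level + 1)).comp G.subtype) (ker_levelPerm_le hb.2)
    (card_levelPerm_ne_zero hF _) (fun _ hh => eq_one_of_levelPerm h.occurs hh) ⊤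
    (fun _ _ _ => trivial) (f := f₀) trivial hf₀
  -- The vertex `c` need not lie below `a`; translation by `k` conjugates St(b) into St(c).
  obtain ⟨k, hk⟩ := exists_smul_eq hG.1 (hb.2.trans hc.symm)
  refine ⟨ind G a π k f, fun h0 => hf ?_, fun g hg => ?_⟩
  · have : ind G a π k⁻¹ (ind G a π k f) = f := by
      rw [← Module.End.mul_apply, ← map_mul, inv_mul_cancel, map_one, Module.End.one_apply]
    rw [← this, h0, map_zero]
  · have hm : k⁻¹ * g * k ∈ St G b := by
      rw [MulAction.mem_stabilizer_iff, mul_smul, mul_smul, hk, MulAction.mem_stabilizer_iff.1 hg,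
        ← hk, inv_smul_smul]
    conv_rhs => rw [← hinv _ hm]
    rw [← Module.End.mul_apply, ← Module.End.mul_apply, ← map_mul, ← map_mul]
    congr 2
    group

/-- Let `c` be the prefix of `a'` one level below `a`, so that St(a') ≤ St(c). The first
representation has a nonzero vector fixed by St(c), while the second has none fixed by St(a'). -/
theorem isEmpty_ind_equiv_of_level_lt (hG : IsLocallyTwoTransitive G)
    (hF : CharNotDvdSteinitzOrder F G.topologicalClosure) {a' : Vertex X}
    {σ : Representation F (St G a') W} (hlt : a.level < a'.level)
    (hπ : IsNontrivialConstituent G a π) (hσ : IsNontrivialConstituent G a' σ) :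
    IsEmpty (Representation.Equiv (ind G a π) (ind G a' σ)) := by
  refine ⟨fun T => ?_⟩
  obtain ⟨ξ, hξ⟩ := exists_boundary_pre_eq a'
  obtain ⟨f, hf, hinv⟩ := exists_invariant_ind hG hF hπ (c := ξ.pre (a.level + 1)) rfl
  refine hf (T.injective ?_)
  rw [map_zero]
  refine ind_eq_zero_of_invariant hG hσ fun g hg => ?_
  have h1 := T.toIntertwiningMap.isIntertwining _ _ g f
  rw [hinv g (stabilizer_pre_le ξ hlt (by rwa [hξ]))] at h1
  exact h1.symm

theorem nonempty_equiv_of_ind_equiv (hG : IsLocallyTwoTransitive G)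
    (hF : CharNotDvdSteinitzOrder F G.topologicalClosure) {σ : Representation F (St G a) W}
    (hπ : IsNontrivialConstituent G a π) (hσ : IsNontrivialConstituent G a σ)
    (T : Representation.Equiv (ind G a π) (ind G a σ)) : Nonempty (Representation.Equiv π σ) := by
  obtain ⟨b, hb⟩ := exists_mem_descendants a
  obtain ⟨l, hl, hlK⟩ := exists_functional hG.1 hπ.irreducible hπ.occurs hb
  obtain ⟨l', hl', hlK'⟩ := exists_functional hG.1 hσ.irreducible hσ.occurs hb
  exact nonempty_equiv_of_coind (stabilizer_le hb) (exists_double_coset hG hb) hπ.irreducible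
    hπ.nontrivial hl hlK _ (ker_levelPerm_le hb.2) (card_levelPerm_ne_zero hF _)
    (fun _ hh => eq_one_of_levelPerm hπ.occurs hh) hσ.irreducible hσ.nontrivial hl' hlK' T

theorem trivial_isIrreducible (H : Type*) [Group H] :
    (Representation.trivial F H F).IsIrreducible := by
  refine isIrreducible_of_forall fun U _ x hx hx0 y => ?_
  have := U.smul_mem (y * x⁻¹) hx
  rwa [smul_eq_mul, inv_mul_cancel_right₀ hx0] at this

theorem nonempty_boundaryRep_equiv_of_constituents (hG : IsLocallyTwoTransitive G)
    (hF : CharNotDvdSteinitzOrder F G.topologicalClosure) {a : ℕ → Vertex X}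
    (ha : ∀ n, (a n).level = n) :
    Nonempty (Representation.Equiv (boundaryRep F G) ((Representation.trivial F G F).prod
      (Representation.directSum fun s : (Σ n : ℕ, Σ c : Irr₀ F G (a n), Fin c.mult) =>
        ind G (a s.1) s.2.1.out.rep))) := by
  have key := fun n => by
    have : FiniteDimensional F (MonoidAlgebra F (descendants (a n))) :=
      (MonoidAlgebra.coeffLinearEquiv F).symm.finiteDimensional
    have hle : (((levelPerm X ((a n).level + 1)).comp G.subtype).comp (St G (a n)).subtype).range ≤
        ((levelPerm X ((a n).level + 1)).comp G.subtype).range := by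
      rintro _ ⟨k, rfl⟩
      exact ⟨k, rfl⟩
    exact exists_constituent_decomposition (F := F) (a := a n)
      (((levelPerm X ((a n).level + 1)).comp G.subtype).comp (St G (a n)).subtype)
      (fun h hh => descRep_eq_one_of_levelPerm hh) fun h => by
        obtain ⟨m, hm⟩ := Subgroup.card_dvd_of_le hle
        refine card_levelPerm_ne_zero hF ((a n).level + 1) ?_
        rw [hm, Nat.cast_mul, h, zero_mul]
  choose ι q h1 h2 h3 using key
  exact nonempty_boundaryRep_equiv hG.1 ha
    (fun n s x hx => eq_zero_of_invariant s.1.out.isConstituent.irreducible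
      s.1.out.isConstituent.nontrivial hx) ι q h1 h2 h3

end Main

end RootedTree

theorem theorem1p1 {F : Type u} [Field F] (X : ℕ → Type v) [∀ i, Finite (X i)]
    [∀ i, Nontrivial (X i)] (G : Subgroup (RootedTree.rootedAut X))
    (hG : RootedTree.IsLocallyTwoTransitive G)
    (hF : RootedTree.CharNotDvdSteinitzOrder F G.topologicalClosure) :
    (∀ (a : RootedTree.Vertex X) (V : Type w) [AddCommGroup V] [Module F V]
      (π : Representation F (RootedTree.St G a) V),
      RootedTree.IsNontrivialConstituent G a π → (RootedTree.ind G a π).IsIrreducible) ∧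
    ∀ a : ℕ → RootedTree.Vertex X, (∀ n, (a n).level = n) →
      -- the decomposition of the boundary representation
      Nonempty (Representation.Equiv (RootedTree.boundaryRep F G)
        ((Representation.trivial F G F).prod
          (Representation.directSum
            fun s : (Σ n : ℕ, Σ c : RootedTree.Irr₀ F G (a n), Fin c.mult) =>
              RootedTree.ind G (a s.1) s.2.1.out.rep))) ∧
      -- its constituents are irreducible
      (Representation.trivial F G F).IsIrreducible ∧
      (∀ (n : ℕ) (c : RootedTree.Irr₀ F G (a n)),
        (RootedTree.ind G (a n) c.out.rep).IsIrreducible) ∧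
      -- its constituents are pairwise distinct
      (∀ (n : ℕ) (c : RootedTree.Irr₀ F G (a n)),
        IsEmpty (Representation.Equiv (Representation.trivial F G F)
          (RootedTree.ind G (a n) c.out.rep))) ∧
      (∀ s t : (Σ n : ℕ, RootedTree.Irr₀ F G (a n)), s ≠ t →
        IsEmpty (Representation.Equiv (RootedTree.ind G (a s.1) s.2.out.rep)
          (RootedTree.ind G (a t.1) t.2.out.rep))) := by
  refine ⟨fun a V _ _ π h => RootedTree.ind_isIrreducible hG hF h, fun a ha =>
    ⟨RootedTree.nonempty_boundaryRep_equiv_of_constituents hG hF ha,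
      RootedTree.trivial_isIrreducible _,
      fun n c => RootedTree.ind_isIrreducible hG hF c.out.isConstituent,
      fun n c => RootedTree.isEmpty_trivial_equiv_ind hG c.out.isConstituent, ?_⟩⟩
  rintro ⟨n, c⟩ ⟨m, d⟩ hne
  rcases lt_trichotomy n m with h | h | h
  · exact RootedTree.isEmpty_ind_equiv_of_level_lt hG hF (by rwa [ha, ha]) c.out.isConstituent
      d.out.isConstituent
  · subst h
    refine ⟨fun T => hne ?_⟩
    have : c = d := Quotient.out_equiv_out.1 (RootedTree.nonempty_equiv_of_ind_equiv hG hF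
      c.out.isConstituent d.out.isConstituent T)
    rw [this]
  · refine ⟨fun T => ?_⟩
    exact (RootedTree.isEmpty_ind_equiv_of_level_lt hG hF (by rwa [ha, ha]) d.out.isConstituent
      c.out.isConstituent).false T.symm
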